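/- **Setting.** Let $\Omega\subset\mathbb R^d$ be open and bounded with $\mathscr L^d(\partial\Omega)=0$, let $E$ be a finite-dimensional Euclidean space with unit sphere $\mathbb S_E$ and open unit ball $\mathbb B_E$, and let $Z=\mathbb R^d/\mathbb Z^d$ with its Lebesgue measure. Put $Q=[-\tfrac12,\tfrac12]^d$, $Q_r(x_0)=x_0+rQ$ and $T^{(x_0,r)}(x)=(x-x_0)/r$. For $D=\Omega$ or $D=Q$: * $\mathbf E^2(D;E)$ is the set of continuous $f:D\times Z\times E\to\mathbb R$ such that $(x,\xi,\hat z)\mapsto(1-|\hat z|)\,f\big(x,\xi,\tfrac{\hat z}{1-|\hat z|}\big)$ extends continuously from $D\times Z\times\mathbb B_E$ to its closure; $f^\infty(x,\xi,z)=\lim_{x'\to x,\ \xi'\to\xi,\ t\to\infty} f(x',\xi',tz)/t$ for $x\in\overline D$. * A two-scale* Young measure $\boldsymbol\nu=(\nu,\lambda,\rho,\nu^\infty)\in\mathbf Y^2(D;E)$ consists of a finite positive measure $\lambda$ on $\overline D$, a weak-* $\lambda$-measurable map $x\mapsto\rho_x\in\mathrm{Prob}(Z)$, a weak-* measurable map $(x,\xi)\mapsto\nu_{x,\xi}\in\mathrm{Prob}(E)$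 on $\overline D\times Z$ with $\int_{\overline D}\int_Z\int_E|z|\,d\nu_{x,\xi}\,d\xi\,dx<\infty$, and a weak-* $(\lambda\otimes\rho_x)$-measurable map $(x,\xi)\mapsto\nu^\infty_{x,\xi}\in\mathrm{Prob}(\mathbb S_E)$. Put $$\langle\!\langle f,\boldsymbol\nu\rangle\!\rangle=\int_D\!\int_Z\!\int_E f\,d\nu_{x,\xi}\,d\xi\,dx+\int_{\overline D}\!\int_Z\!\int_{\mathbb S_E} f^\infty\,d\nu^\infty_{x,\xi}\,d\rho_x(\xi)\,d\lambda(x),$$ and let $\boldsymbol\sigma_j\overset{*}{\rightharpoonup}\boldsymbol\sigma$ mean $\langle\!\langle f,\boldsymbol\sigma_j\rangle\!\rangle\to\langle\!\langle f,\boldsymbol\sigma\rangle\!\rangle$ for all $f\in\mathbf E^2(D;E)$. * For an $E$-valued measure $\mu=\mu^{ac}\mathscr L^d+\mu_s|\mu^s|$ on $D$ (Radon–Nikodým–Lebesgue decomposition) put $I^\epsilon_f(\mu)=\int_D f(x,\tfrac x\epsilon,\mu^{ac}(x))\,dx+\int_D f^\infty(x,\tfrac x\epsilon,\mu_s(x))\,d|\mu^s|(x)$.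 Measures $(\mu_i)\subset\mathcal M(D;E)$ generate $\boldsymbol\nu$ along scales $\epsilon_i>0$, $\epsilon_i\to0$, if $I^{\epsilon_i}_f(\mu_i)\to\langle\!\langle f,\boldsymbol\nu\rangle\!\rangle$ for all $f\in\mathbf E^2(D;E)$. * For a finite positive measure $\kappa$ on $\overline\Omega$, $\mathrm{Tan}_1(\kappa,x_0)$ is the set of probability measures on $Q$ that are weak-* limits of $\kappa(Q_{r_j}(x_0))^{-1}\,T^{(x_0,r_j)}_\#\kappa$ restricted to $Q$, for some $r_j\to0$ with $r_j>0$ and $\kappa(Q_{r_j}(x_0))>0$. **Proposition.** Let $\boldsymbol\nu=(\nu,\lambda,\rho,\nu^\infty)\in\mathbf Y^2(\Omega;E)$ be generated by $(\mu_i)\subset\mathcal M(\Omega;E)$ along scales $\epsilon_i$, and let $\lambda^s$ be the singular part of $\lambda$ with respect to $\mathscr L^d$. There is $S\subset\Omega$ with $\lambda^s(\Omega\setminus S)=0$ such that for every $x_0\in S$ there are $\xi_0\in Z$ and $\boldsymbol{D\nu}=(D\nu,D\lambda,D\rho,D\nu^\infty)\in\mathbf Y^2(Q;E)$ with the following properties.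 1. $\boldsymbol{D\nu}$ is a local tangent two-scale* Young measure at $x_0$: there are radii $r_j>0$, $r_j\to0$, with $c_j:=\lambda^s(Q_{r_j}(x_0))^{-1}<\infty$, and a subsequence $(\mu_{i_n})_n$ such that (a) for every $j$ the measures $c_jT^{(x_0,r_j)}_\#\mu_{i_n}$ restricted to $Q$ generate, as $n\to\infty$ and along the scales $\epsilon_{i_n}/r_j$, some $\boldsymbol\sigma^{(j)}\in\mathbf Y^2(Q;E)$, and $\boldsymbol\sigma^{(j)}\overset{*}{\rightharpoonup}\boldsymbol{D\nu}$ as $j\to\infty$; (b) for suitable $n_1<n_2<\dots$ the measures $c_jT^{(x_0,r_j)}_\#\mu_{i_{n_j}}$ restricted to $Q$ generate $\boldsymbol{D\nu}$ along the scales $\epsilon_{i_{n_j}}/r_j$. 2. $D\lambda\in\mathrm{Tan}_1(\lambda^s,x_0)$. 3. $D\rho_y=\Gamma^{\xi_0}_\#\rho_{x_0}$ for $D\lambda$-a.e. $y\in Q$, where $\Gamma^{\xi_0}(\xi)=\xi-\xi_0$. 4. $D\nu_{y,\xi}=\delta_0$ for $(\mathscr L^d\otimes\mathscr L^d_Z)$-a.e.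 $(y,\xi)\in Q\times Z$. 5. $D\nu^\infty_{y,\xi}=\nu^\infty_{x_0,\xi+\xi_0}$ for $(D\lambda\otimes D\rho_y)$-a.e. $(y,\xi)\in Q\times Z$. -/

import Mathlib

open MeasureTheory Set Filter Topology

noncomputable section

/-- The macroscopic space `ℝ^d` with its Euclidean structure. -/
abbrev Space (d : ℕ) := EuclideanSpace ℝ (Fin d)

/-- The flat torus `Z = ℝ^d / ℤ^d`; its `volume` is the normalized Lebesgue (Haar) measure. -/
abbrev Torus (d : ℕ) := UnitAddTorus (Fin d)

/-- The class `⟨x⟩ ∈ Z` of a point `x ∈ ℝ^d`. -/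
def toTorus {d : ℕ} (x : Space d) : Torus d := fun k => ((x k : ℝ) : UnitAddCircle)

/-- The closed cube `Q_r(x₀)` with centre `x₀` and side length `r`. -/
def cube {d : ℕ} (x₀ : Space d) (r : ℝ) : Set (Space d) := {x | ∀ k, |x k - x₀ k| ≤ r / 2}

/-- The closed unit cube `Q`, centred at the origin. -/
def unitCube (d : ℕ) : Set (Space d) := cube 0 1

/-- The blow-up map `T^{(x₀,r)}(x) = (x - x₀) / r`, which maps `Q_r(x₀)` onto `Q`. -/
def blowMap {d : ℕ} (x₀ : Space d) (r : ℝ) (x : Space d) : Space d := r⁻¹ • (x - x₀)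

/-! ### Vector measures: Radon--Nikodym--Lebesgue decomposition and blow-ups -/

section VectorMeasures

variable {X : Type*} [MeasurableSpace X]
  {E : Type*} [NormedAddCommGroup E] [InnerProductSpace ℝ E] [FiniteDimensional ℝ E]

/-- The signed measure `B ↦ ⟪e, μ B⟫`. -/
def vectorCoord (μ : VectorMeasure X E) (e : E) : SignedMeasure X :=
  μ.mapRange (innerSL ℝ e).toLinearMap.toAddMonoidHom (innerSL ℝ e).continuous

/-- The Radon--Nikodym density `dμ/dm : X → E` of a vector measure `μ` with respect to a positive
measure `m` (the density of the part of `μ` which is absolutely continuous with respect to `m`),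
computed in an orthonormal basis of `E`. -/
def vectorDensity (μ : VectorMeasure X E) (m : Measure X) (x : X) : E :=
  ∑ k, (vectorCoord μ (stdOrthonormalBasis ℝ E k)).rnDeriv m x • stdOrthonormalBasis ℝ E k

end VectorMeasures

section Decomposition

variable {d : ℕ} {E : Type*} [NormedAddCommGroup E] [InnerProductSpace ℝ E] [FiniteDimensional ℝ E]

/-- `μ^{ac} = dμ/dL^d`. -/
def acDensity (μ : VectorMeasure (Space d) E) : Space d → E := vectorDensity μ volume

/-- The singular part `μ^s = μ - μ^{ac} L^d`. -/
def singPart (μ : VectorMeasure (Space d) E) : VectorMeasure (Space d) E :=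
  μ - (volume : Measure (Space d)).withDensityᵥ (acDensity μ)

/-- The total variation `|μ^s|` of the singular part. -/
def singVariation (μ : VectorMeasure (Space d) E) : Measure (Space d) := (singPart μ).variation

/-- The polar density `μ_s = dμ/d|μ^s|`, so that `μ = μ^{ac} L^d + μ_s |μ^s|`. -/
def singDensity (μ : VectorMeasure (Space d) E) : Space d → E :=
  vectorDensity (singPart μ) (singVariation μ)

/-- The rescaled blow-up `c T^{(x₀,r)}_# μ`, as a vector measure on the closed unit cube. -/
def blowUp (c : ℝ) (x₀ : Space d) (r : ℝ) (μ : VectorMeasure (Space d) E) :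
    VectorMeasure (Space d) E :=
  c • (μ.map (blowMap x₀ r)).restrict (unitCube d)

end Decomposition

/-! ### Tangent measures of positive measures -/

/-- The normalized blow-up `κ(Q_r(x₀))⁻¹ T^{(x₀,r)}_# κ` on the closed unit cube. -/
def blowUpProb {d : ℕ} (κ : Measure (Space d)) (x₀ : Space d) (r : ℝ) : Measure (Space d) :=
  (κ (cube x₀ r))⁻¹ • (κ.map (blowMap x₀ r)).restrict (unitCube d)

/-- `τ ∈ Tan₁(κ, x₀)`: the probability measure `τ` on the closed cube `Q` is the weak-* limit in
`M(Q) = C(Q)*` of normalized blow-ups of `κ` at `x₀` along some radii `r_j → 0`. -/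
def IsTangentMeasure {d : ℕ} (κ : Measure (Space d)) (x₀ : Space d) (τ : Measure (Space d)) :
    Prop :=
  IsProbabilityMeasure τ ∧ τ (unitCube d)ᶜ = 0 ∧
    ∃ r : ℕ → ℝ, (∀ j, 0 < r j) ∧ Tendsto r atTop (𝓝 0) ∧ (∀ j, 0 < κ (cube x₀ (r j))) ∧
      ∀ φ : Space d → ℝ, Continuous φ →
        Tendsto (fun j => ∫ y, φ y ∂(blowUpProb κ x₀ (r j))) atTop (𝓝 (∫ y, φ y ∂τ))

/-! ### Integrands -/

section Integrands

variable {d : ℕ} {E : Type*} [NormedAddCommGroup E] [InnerProductSpace ℝ E]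

/-- The class `E²(D; E)` of continuous integrands `f` on `D × Z × E` for which
`(Tf)(x,ξ,ẑ) = (1 - |ẑ|) f(x, ξ, ẑ / (1 - |ẑ|))`, defined for `|ẑ| < 1`, extends continuously to
the closure of `D × Z × 𝔹_E`. Values of `f` at points `x ∉ D` are irrelevant. -/
structure IsIntegrand (D : Set (Space d)) (f : Space d → Torus d → E → ℝ) : Prop where
  continuousOn : ContinuousOn (fun p : Space d × Torus d × E => f p.1 p.2.1 p.2.2) (D ×ˢ univ)
  extends_continuously : ∃ g : Space d × Torus d × E → ℝ,
    ContinuousOn g (closure (D ×ˢ ((univ : Set (Torus d)) ×ˢ Metric.ball (0 : E) 1))) ∧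
      ∀ x ∈ D, ∀ ξ : Torus d, ∀ z ∈ Metric.ball (0 : E) 1,
        g (x, ξ, z) = (1 - ‖z‖) * f x ξ ((1 - ‖z‖)⁻¹ • z)

/-- The strong recession function `f^∞(x,ξ,z) = lim f(x',ξ',tz)/t` as `x' → x` in `D`, `ξ' → ξ` and
`t → ∞`, for `x` in the closure of `D`. The limit exists for all integrands in `E²(D; E)`. -/
def recession (D : Set (Space d)) (f : Space d → Torus d → E → ℝ)
    (x : Space d) (ξ : Torus d) (z : E) : ℝ :=
  limUnder (𝓝[D] x ×ˢ (𝓝 ξ ×ˢ (atTop : Filter ℝ)))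
    (fun p : Space d × Torus d × ℝ => f p.1 p.2.1 (p.2.2 • z) / p.2.2)

end Integrands

/-! ### Two-scale* Young measures -/

/-- The generalized product `λ ⊗ ρ_x`, i.e. `(λ ⊗ ρ_x)(U) = ∫ ∫ χ_U(x,ξ) dρ_x(ξ) dλ(x)`. -/
def semiProd {X Y : Type*} [MeasurableSpace X] [MeasurableSpace Y] (lam : Measure X)
    (ρ : X → Measure Y) : Measure (X × Y) :=
  lam.bind fun x => (ρ x).map (Prod.mk x)

/-- A two-scale* Young measure `(ν, λ, ρ, ν^∞)` on `D` with values in `E`. Weak-* measurability of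
a measure-valued map is a.e.-measurability for the `σ`-algebra generated by the evaluations on
measurable sets; as usual, the maps only matter up to null sets. -/
structure TwoScaleYoungMeasure {d : ℕ} (D : Set (Space d)) (E : Type*) [NormedAddCommGroup E]
    [InnerProductSpace ℝ E] [MeasurableSpace E] where
  /-- the oscillation part `ν_{x,ξ}` -/
  osc : Space d → Torus d → Measure E
  /-- the concentration measure `λ` on the closure of `D` -/
  lam : Measure (Space d)
  /-- the microscopic distribution `ρ_x` of the concentrations -/
  rho : Space d → Measure (Torus d)
  /-- the concentration part `ν^∞_{x,ξ}`, on the unit sphere of `E` -/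
  conc : Space d → Torus d → Measure (Metric.sphere (0 : E) 1)
  osc_measurable : AEMeasurable (fun p : Space d × Torus d => osc p.1 p.2)
    ((volume.restrict (closure D)).prod volume)
  osc_prob : ∀ᵐ p : Space d × Torus d ∂((volume.restrict (closure D)).prod volume),
    IsProbabilityMeasure (osc p.1 p.2)
  osc_moment : ∫⁻ p : Space d × Torus d, (∫⁻ z, ‖z‖ₑ ∂(osc p.1 p.2))
    ∂((volume.restrict (closure D)).prod volume) < ⊤
  lam_finite : IsFiniteMeasure lam
  lam_support : lam (closure D)ᶜ = 0
  rho_measurable : AEMeasurable rho lam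
  rho_prob : ∀ᵐ x ∂lam, IsProbabilityMeasure (rho x)
  conc_measurable : AEMeasurable (fun p : Space d × Torus d => conc p.1 p.2) (semiProd lam rho)
  conc_prob : ∀ᵐ p : Space d × Torus d ∂(semiProd lam rho), IsProbabilityMeasure (conc p.1 p.2)

section Young

variable {d : ℕ} {E : Type*} [NormedAddCommGroup E] [InnerProductSpace ℝ E] [MeasurableSpace E]

/-- The singular part `λ^s` of `λ` with respect to the Lebesgue measure. -/
def TwoScaleYoungMeasure.lamSing {D : Set (Space d)} (ν : TwoScaleYoungMeasure D E) :
    Measure (Space d) :=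
  ν.lam.singularPart volume

/-- The duality pairing `⟪⟪f, ν⟫⟫` of an integrand in `E²(D; E)` with a Young measure on `D`. -/
def youngPairing {D : Set (Space d)} (f : Space d → Torus d → E → ℝ)
    (ν : TwoScaleYoungMeasure D E) : ℝ :=
  (∫ x in D, ∫ ξ : Torus d, ∫ z, f x ξ z ∂(ν.osc x ξ)) +
    ∫ x in closure D, (∫ ξ, (∫ z : Metric.sphere (0 : E) 1, recession D f x ξ (z : E)
      ∂(ν.conc x ξ)) ∂(ν.rho x)) ∂ν.lam

/-- Weak-* convergence of Young measures on `D`, in the dual of `E²(D; E)`. -/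
def WeakStarTendsto {D : Set (Space d)} (σ : ℕ → TwoScaleYoungMeasure D E)
    (τ : TwoScaleYoungMeasure D E) : Prop :=
  ∀ f : Space d → Torus d → E → ℝ, IsIntegrand D f →
    Tendsto (fun j => youngPairing f (σ j)) atTop (𝓝 (youngPairing f τ))

variable [FiniteDimensional ℝ E]

/-- The functional
`I^ε_f(μ) = ∫_D f(x, x/ε, μ^{ac}) dx + ∫_D f^∞(x, x/ε, μ_s) d|μ^s|`. -/
def twoScaleFunctional (D : Set (Space d)) (f : Space d → Torus d → E → ℝ) (ε : ℝ)
    (μ : VectorMeasure (Space d) E) : ℝ :=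
  (∫ x in D, f x (toTorus (ε⁻¹ • x)) (acDensity μ x)) +
    ∫ x in D, recession D f x (toTorus (ε⁻¹ • x)) (singDensity μ x) ∂(singVariation μ)

/-- The measures `μ_i ∈ M(D; E)` generate, along the infinitesimal positive scales `ε_i`, the
two-scale* Young measure `ν` on `D`. Measures on `D` are identified with their extensions by zero
to `ℝ^d`. -/
structure Generates {D : Set (Space d)} (ε : ℕ → ℝ) (μ : ℕ → VectorMeasure (Space d) E)
    (ν : TwoScaleYoungMeasure D E) : Prop where
  scale_pos : ∀ i, 0 < ε i
  scale_tendsto : Tendsto ε atTop (𝓝 0)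
  supported : ∀ i, (μ i).restrict D = μ i
  tendsto : ∀ f : Space d → Torus d → E → ℝ, IsIntegrand D f →
    Tendsto (fun i => twoScaleFunctional D f (ε i) (μ i)) atTop (𝓝 (youngPairing f ν))

/-- `τ` is a local tangent two-scale* Young measure at `x₀` obtained by blowing up the generating
sequence `(μ_i)`, with blow-ups normalized by `κ(Q_r(x₀))⁻¹` and with the rescaled microscopic scales
`ε_i / r`. There are radii `r_j → 0` and a subsequence of `(μ_i)` such that

* for each fixed `j` the blow-ups at radius `r_j` of the subsequence generate some `σ_j` on `Q`, and
  `σ_j` converges weakly-* to `τ`;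
* a diagonal sequence of these blow-ups generates `τ` itself. -/
def IsTangentYoungMeasure (ε : ℕ → ℝ) (μ : ℕ → VectorMeasure (Space d) E)
    (κ : Measure (Space d)) (x₀ : Space d) (τ : TwoScaleYoungMeasure (unitCube d) E) : Prop :=
  ∃ r : ℕ → ℝ, (∀ j, 0 < r j) ∧ Tendsto r atTop (𝓝 0) ∧ (∀ j, 0 < κ (cube x₀ (r j))) ∧
    ∃ s : ℕ → ℕ, StrictMono s ∧
      (∃ σ : ℕ → TwoScaleYoungMeasure (unitCube d) E,
        (∀ j, Generates (fun i => ε (s i) / r j)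
          (fun i => blowUp (κ (cube x₀ (r j))).toReal⁻¹ x₀ (r j) (μ (s i))) (σ j)) ∧
        WeakStarTendsto σ τ) ∧
      ∃ k : ℕ → ℕ, StrictMono k ∧
        Generates (fun j => ε (s (k j)) / r j)
          (fun j => blowUp (κ (cube x₀ (r j))).toReal⁻¹ x₀ (r j) (μ (s (k j)))) τ

end Young

end

set_option linter.unusedSectionVars false

noncomputable section

/-! ### Lebesgue decomposition of vector measures, coordinate by coordinate -/

section VectorMeasureDensity

variable {X : Type*} [MeasurableSpace X]
  {E : Type*} [NormedAddCommGroup E] [InnerProductSpace ℝ E] [FiniteDimensional ℝ E]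

/-! Everything is transferred to weak convergence of finite positive measures on the phase space
`Phase d E` of triples (x, ξ, w). On bounded D, an integrand of E² is f = (1 + |z|) g(x, ξ, z/(1 +
|z|)) with g bounded and continuous, and its recession function is |z| g(x, ξ, z/|z|). Hence both
I^ε_f(μ) and the pairing of f with a Young measure are integrals of g against positive measures,
`functionalLift` and `YoungKernels.lift`, and generation becomes weak convergence (`generates_iff`).

For a fixed radius r, blowing up acts on both kinds of lift through the same pull-back of test
functions (`integral_functionalLift_blowUp`, `integral_lift_blow`). The only trace of ε is a
microscopic shift by the class of x₀/ε, because the rescaled microscopic variable is x/ε - x₀/ε. By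
compactness of the torus this shift converges to some ξ₀ along a subsequence, and ξ₀ does not depend
on r. If λ and Lebesgue measure do not charge the boundary of Q_r(x₀), restriction to the cube
commutes with the weak limit, so the blow-ups generate an explicit Young measure `YoungKernels.blow`
(`generates_blow`).

Next r tends to 0 with normalization c = 1/λ^s(Q_r(x₀)). The first moment of ν and the absolutely
continuous part of λ are absolutely continuous, hence negligible against λ^s on small cubes around
λ^s-almost every x₀, by Besicovitch differentiation. The vanishing first moment collapses the
oscillation part to δ₀ (`tendsto_osc_blow`). At a Lebesgue point of all angular averages the
concentration part freezes at its value at x₀, while λ^s itself blows up to a tangent measure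
(`ae_lebesgue_point_angularAverage`, `tendsto_conc_blow`). Weak convergence of nonzero finite
measures can be measured by a metric, so a diagonal sequence generates the limit directly
(`exists_diagonal_weak`). -/

theorem vectorCoord_apply (μ : VectorMeasure X E) (e : E) (s : Set X) :
    vectorCoord μ e s = inner ℝ e (μ s) := rfl

theorem integrable_vectorDensity (μ : VectorMeasure X E) (m : Measure X) :
    Integrable (vectorDensity μ m) m := by
  unfold vectorDensity
  exact integrable_finsetSum _ fun k _ => (SignedMeasure.integrable_rnDeriv _ _).smul_const _

theorem measurable_vectorDensity [MeasurableSpace E] [BorelSpace E]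
    (μ : VectorMeasure X E) (m : Measure X) : Measurable (vectorDensity μ m) := by
  unfold vectorDensity
  exact Finset.measurable_sum _ fun k _ => (SignedMeasure.measurable_rnDeriv _ _).smul_const _

theorem vectorCoord_withDensity {m : Measure X} {h : X → E} (hh : Integrable h m) (e : E) :
    vectorCoord (m.withDensityᵥ h) e = m.withDensityᵥ (fun x => inner ℝ e (h x)) := by
  ext s hs
  rw [vectorCoord_apply, withDensityᵥ_apply hh hs, withDensityᵥ_apply (hh.const_inner e) hs]
  exact (integral_inner hh.integrableOn e).symm

theorem inner_vectorDensity (μ : VectorMeasure X E) (m : Measure X) (x : X)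
    (k : Fin (Module.finrank ℝ E)) :
    inner ℝ (stdOrthonormalBasis ℝ E k) (vectorDensity μ m x) =
      (vectorCoord μ (stdOrthonormalBasis ℝ E k)).rnDeriv m x := by
  have h := (stdOrthonormalBasis ℝ E).orthonormal
  rw [vectorDensity, Orthonormal.inner_right_fintype h]

/-- Uniqueness of the Lebesgue decomposition of each coordinate. It is applied twice to blow-ups: to
the absolutely continuous density, and with `t = 0` to the polar density. -/
theorem vectorDensity_unique {m : Measure X} {μ t : VectorMeasure X E} {h : X → E}
    (hh : Integrable h m) (ht : t ⟂ᵥ m.toENNRealVectorMeasure) (hμ : μ = t + m.withDensityᵥ h) :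
    vectorDensity μ m =ᵐ[m] h := by
  have key : ∀ k, (fun x => inner ℝ (stdOrthonormalBasis ℝ E k) (h x)) =ᵐ[m]
      (vectorCoord μ (stdOrthonormalBasis ℝ E k)).rnDeriv m := by
    intro k
    refine SignedMeasure.eq_rnDeriv (vectorCoord t (stdOrthonormalBasis ℝ E k)) _
      (hh.const_inner _) ?_ ?_
    · obtain ⟨s, hs, h1, h2⟩ := ht
      exact ⟨s, hs, fun u hu => by rw [vectorCoord_apply, h1 u hu, inner_zero_right], h2⟩
    · rw [← vectorCoord_withDensity hh, hμ]
      ext s _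
      simp [vectorCoord_apply, inner_add_right]
  filter_upwards [ae_all_iff.2 key] with x hx
  rw [← (stdOrthonormalBasis ℝ E).sum_repr' (h x), vectorDensity]
  exact Finset.sum_congr rfl fun k _ => by rw [hx k]

/-- Each coordinate has its own separating set; their finite intersection works for the vector,
since its complement is a finite union of null sets. -/
theorem mutuallySingular_sub_vectorDensity (μ : VectorMeasure X E) (m : Measure X) [SigmaFinite m] :
    (μ - m.withDensityᵥ (vectorDensity μ m)) ⟂ᵥ m.toENNRealVectorMeasure := by
  set t := μ - m.withDensityᵥ (vectorDensity μ m)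
  have hk : ∀ k, vectorCoord t (stdOrthonormalBasis ℝ E k) =
      (vectorCoord μ (stdOrthonormalBasis ℝ E k)).singularPart m := by
    intro k
    have h1 := SignedMeasure.singularPart_add_withDensity_rnDeriv_eq
      (s := vectorCoord μ (stdOrthonormalBasis ℝ E k)) (μ := m)
    have h2 : vectorCoord t (stdOrthonormalBasis ℝ E k) =
        vectorCoord μ (stdOrthonormalBasis ℝ E k) -
          vectorCoord (m.withDensityᵥ (vectorDensity μ m)) (stdOrthonormalBasis ℝ E k) := by
      ext s _
      simp [vectorCoord_apply, t, inner_sub_right]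
    rw [h2, vectorCoord_withDensity (integrable_vectorDensity μ m)]
    simp only [inner_vectorDensity]
    rw [sub_eq_iff_eq_add, h1]
  have hs : ∀ k, vectorCoord t (stdOrthonormalBasis ℝ E k) ⟂ᵥ m.toENNRealVectorMeasure :=
    fun k => by rw [hk k]; exact SignedMeasure.mutuallySingular_singularPart _ _
  choose s hs h1 h2 using hs
  refine VectorMeasure.MutuallySingular.mk (⋂ k, s k) (MeasurableSet.iInter hs) ?_ ?_
  · intro u hu _
    rw [← (stdOrthonormalBasis ℝ E).sum_repr' (t u)]
    refine Finset.sum_eq_zero fun k _ => ?_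
    have := h1 k u (hu.trans (iInter_subset _ k))
    rw [vectorCoord_apply] at this
    rw [this, zero_smul]
  · intro u hu hum
    rw [Measure.toENNRealVectorMeasure_apply_measurable hum]
    refine measure_mono_null (t := ⋃ k, (s k)ᶜ) (by rwa [← compl_iInter]) ?_
    refine measure_iUnion_null fun k => ?_
    have := h2 k (s k)ᶜ le_rfl
    rwa [Measure.toENNRealVectorMeasure_apply_measurable (hs k).compl] at this

theorem withDensity_vectorDensity_of_null {μ : VectorMeasure X E} {m : Measure X} [SigmaFinite m]
    (h : ∀ s, MeasurableSet s → m s = 0 → μ s = 0) :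
    m.withDensityᵥ (vectorDensity μ m) = μ := by
  ext1 s hs
  have key : ∀ k, inner ℝ (stdOrthonormalBasis ℝ E k) (m.withDensityᵥ (vectorDensity μ m) s) =
      inner ℝ (stdOrthonormalBasis ℝ E k) (μ s) := by
    intro k
    rw [← vectorCoord_apply, ← vectorCoord_apply,
      vectorCoord_withDensity (integrable_vectorDensity μ m)]
    simp only [inner_vectorDensity]
    rw [SignedMeasure.withDensityᵥ_rnDeriv_eq]
    refine VectorMeasure.AbsolutelyContinuous.mk fun u hu hmu => ?_
    rw [Measure.toENNRealVectorMeasure_apply_measurable hu] at hmu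
    rw [vectorCoord_apply, h u hu hmu, inner_zero_right]
  rw [← (stdOrthonormalBasis ℝ E).sum_repr' (μ s),
    ← (stdOrthonormalBasis ℝ E).sum_repr' (m.withDensityᵥ (vectorDensity μ m) s)]
  simp only [key]

/-- The variation is dominated by the sum of the total variations of the coordinates, which are
finite. -/
theorem isFiniteMeasure_variation (μ : VectorMeasure X E) : IsFiniteMeasure μ.variation := by
  have hle : μ.variation ≤
      ∑ k, (vectorCoord μ (stdOrthonormalBasis ℝ E k)).totalVariation := by
    refine VectorMeasure.variation_le_of_forall_enorm_le fun s _ => ?_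
    rw [Measure.finsetSum_apply]
    have h1 : μ s = ∑ k, vectorCoord μ (stdOrthonormalBasis ℝ E k) s • stdOrthonormalBasis ℝ E k :=
      ((stdOrthonormalBasis ℝ E).sum_repr' (μ s)).symm
    calc ‖μ s‖ₑ ≤ ∑ k, ‖vectorCoord μ (stdOrthonormalBasis ℝ E k) s •
          stdOrthonormalBasis ℝ E k‖ₑ := by
          conv_lhs => rw [h1]
          exact enorm_sum_le _ _
      _ ≤ _ := Finset.sum_le_sum fun k _ => by
          rw [enorm_smul]
          have : ‖stdOrthonormalBasis ℝ E k‖ₑ = 1 := by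
            rw [← ofReal_norm, (stdOrthonormalBasis ℝ E).norm_eq_one, ENNReal.ofReal_one]
          rw [this, mul_one]
          exact SignedMeasure.enorm_le_totalVariation _ _
  have hf : ∀ k, IsFiniteMeasure
      (vectorCoord μ (stdOrthonormalBasis ℝ E k)).totalVariation := fun k => by
    unfold SignedMeasure.totalVariation; infer_instance
  exact isFiniteMeasure_of_le _ hle

end VectorMeasureDensity

/-! ### How the two densities transform under blow-up -/

section BlowUp

variable {d : ℕ} {E : Type*} [NormedAddCommGroup E] [InnerProductSpace ℝ E] [FiniteDimensional ℝ E]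

/-- The blow-up map as a homeomorphism, with inverse `y ↦ x₀ + r y`. -/
def blowHomeo (x₀ : Space d) {r : ℝ} (hr : r ≠ 0) : Space d ≃ₜ Space d where
  toFun := blowMap x₀ r
  invFun y := x₀ + r • y
  left_inv x := by simp [blowMap, smul_smul, hr]
  right_inv y := by simp [blowMap, smul_smul, hr]
  continuous_toFun := by unfold blowMap; fun_prop
  continuous_invFun := by fun_prop

theorem blowMap_continuous (x₀ : Space d) (r : ℝ) : Continuous (blowMap x₀ r) := by
  unfold blowMap; fun_prop

theorem blowMap_inverse (x₀ : Space d) {r : ℝ} (hr : r ≠ 0) (x : Space d) :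
    x₀ + r • blowMap x₀ r x = x := (blowHomeo x₀ hr).left_inv x

theorem measurableEmbedding_blowMap (x₀ : Space d) {r : ℝ} (hr : r ≠ 0) :
    MeasurableEmbedding (blowMap x₀ r) :=
  (blowHomeo x₀ hr).measurableEmbedding

theorem isClosed_cube (x₀ : Space d) (r : ℝ) : IsClosed (cube x₀ r) := by
  have : cube x₀ r = ⋂ k, {x : Space d | |x k - x₀ k| ≤ r / 2} := by
    ext; simp [cube]
  rw [this]
  exact isClosed_iInter fun k => isClosed_le (by fun_prop) continuous_const

theorem isClosed_unitCube : IsClosed (unitCube d) := isClosed_cube _ _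

theorem preimage_blowMap_unitCube (x₀ : Space d) {r : ℝ} (hr : 0 < r) :
    blowMap x₀ r ⁻¹' unitCube d = cube x₀ r := by
  ext x
  simp only [unitCube, cube, blowMap, mem_preimage, mem_ofPred_eq, PiLp.smul_apply,
    PiLp.sub_apply, smul_eq_mul, abs_mul, abs_inv, abs_of_pos hr, PiLp.zero_apply, sub_zero]
  refine forall_congr' fun k => ?_
  rw [inv_mul_le_iff₀ hr]
  ring_nf

theorem map_blowMap_volume (x₀ : Space d) {r : ℝ} (hr : 0 < r) :
    (volume : Measure (Space d)).map (blowMap x₀ r) = ENNReal.ofReal (r ^ d) • volume := by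
  have h : blowMap x₀ r = (fun y => r⁻¹ • y) ∘ fun x => x + -x₀ := by
    ext; simp [blowMap, sub_eq_add_neg]
  rw [h, ← Measure.map_map (by fun_prop) (by fun_prop), map_add_right_eq_self,
    Measure.map_addHaar_smul _ (inv_ne_zero hr.ne')]
  simp [abs_of_pos hr]

theorem restrict_map_blowMap (m : Measure (Space d)) (x₀ : Space d) {r : ℝ} (hr : 0 < r) :
    (m.map (blowMap x₀ r)).restrict (unitCube d) =
      (m.restrict (cube x₀ r)).map (blowMap x₀ r) := by
  rw [(measurableEmbedding_blowMap x₀ hr.ne').restrict_map, preimage_blowMap_unitCube x₀ hr]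

theorem blowUp_apply (c : ℝ) (x₀ : Space d) (r : ℝ) (μ : VectorMeasure (Space d) E)
    {s : Set (Space d)} (hs : MeasurableSet s) :
    blowUp c x₀ r μ s = c • μ (blowMap x₀ r ⁻¹' (s ∩ unitCube d)) := by
  rw [blowUp, smul_apply,
    VectorMeasure.restrict_apply _ isClosed_unitCube.measurableSet hs,
    VectorMeasure.map_apply _ (blowMap_continuous x₀ r).measurable
      (hs.inter isClosed_unitCube.measurableSet)]

/-- The factor r^d comes from the image of Lebesgue measure under the blow-up map. The blown-up
singular part is still singular, so blowing up the decomposition of μ gives a Lebesgue decomposition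
of the blow-up, and uniqueness yields both claims. -/
theorem acDensity_blowUp (c : ℝ) (x₀ : Space d) {r : ℝ} (hr : 0 < r)
    (μ : VectorMeasure (Space d) E) :
    acDensity (blowUp c x₀ r μ) =ᵐ[volume]
      (unitCube d).indicator (fun y => (c * r ^ d) • acDensity μ (x₀ + r • y)) ∧
    singPart (blowUp c x₀ r μ) = blowUp c x₀ r (singPart μ) := by
  have hQ : MeasurableSet (unitCube d) := isClosed_unitCube.measurableSet
  set h : Space d → E := fun y => acDensity μ (x₀ + r • y)
  have hac : Integrable (acDensity μ) volume := integrable_vectorDensity _ _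
  have hemb := measurableEmbedding_blowMap (d := d) x₀ hr.ne'
  have hcomp : h ∘ blowMap x₀ r = acDensity μ := by
    ext x; simp [h, blowMap_inverse x₀ hr.ne']
  have hrd : ENNReal.ofReal (r ^ d) ≠ 0 := by simpa using pow_pos hr d
  have hint : Integrable h volume := by
    have : Integrable h ((volume : Measure (Space d)).map (blowMap x₀ r)) := by
      rw [hemb.integrable_map_iff, hcomp]; exact hac
    rw [map_blowMap_volume x₀ hr] at this
    exact (integrable_smul_measure hrd ENNReal.ofReal_ne_top).1 this
  have hint' : Integrable ((unitCube d).indicator fun y => (c * r ^ d) • h y) volume :=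
    (hint.smul (c * r ^ d)).indicator hQ
  have hdens : (volume : Measure (Space d)).withDensityᵥ
        ((unitCube d).indicator fun y => (c * r ^ d) • h y) =
      blowUp c x₀ r ((volume : Measure (Space d)).withDensityᵥ (acDensity μ)) := by
    ext1 s hs
    rw [blowUp_apply _ _ _ _ hs, withDensityᵥ_apply hint' hs,
      withDensityᵥ_apply hac (hemb.measurable (hs.inter hQ)), setIntegral_indicator hQ,
      ← hcomp]
    have := hemb.setIntegral_map (μ := volume) h (s ∩ unitCube d)
    rw [map_blowMap_volume x₀ hr] at this
    simp only [Function.comp_def]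
    rw [← this, Measure.restrict_smul, integral_smul_measure, integral_smul, smul_smul,
      ENNReal.toReal_ofReal (pow_pos hr d).le]
  have hsum : blowUp c x₀ r μ = blowUp c x₀ r (singPart μ) +
      (volume : Measure (Space d)).withDensityᵥ
        ((unitCube d).indicator fun y => (c * r ^ d) • h y) := by
    rw [hdens]
    ext1 s hs
    simp only [add_apply, blowUp_apply _ _ _ _ hs, singPart,
      sub_apply]
    rw [← smul_add, sub_add_cancel]
  have hsing : blowUp c x₀ r (singPart μ) ⟂ᵥ
      (volume : Measure (Space d)).toENNRealVectorMeasure := by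
    obtain ⟨s, hs, h1, h2⟩ := mutuallySingular_sub_vectorDensity μ (volume : Measure (Space d))
    have hpre : blowMap x₀ r ⁻¹' ((blowHomeo x₀ hr.ne').symm ⁻¹' s) = s := by
      ext x; simp [blowHomeo, blowMap_inverse x₀ hr.ne']
    have hms : MeasurableSet ((blowHomeo x₀ hr.ne').symm ⁻¹' s) :=
      (blowHomeo x₀ hr.ne').symm.continuous.measurable hs
    refine VectorMeasure.MutuallySingular.mk _ hms ?_ ?_
    · intro t ht htm
      rw [blowUp_apply _ _ _ _ htm, singPart, acDensity, h1, smul_zero]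
      intro x hx
      have := ht hx.1
      rw [← hpre]; exact this
    · intro t ht htm
      rw [Measure.toENNRealVectorMeasure_apply_measurable htm]
      have h3 : volume (blowMap x₀ r ⁻¹' t) = 0 := by
        have := h2 (blowMap x₀ r ⁻¹' t) ?_
        · rwa [Measure.toENNRealVectorMeasure_apply_measurable (hemb.measurable htm)] at this
        · intro x hx hxs
          rw [← hpre] at hxs
          exact ht hx hxs
      rw [← Measure.map_apply hemb.measurable htm, map_blowMap_volume x₀ hr] at h3
      simpa [hrd] using h3
  have hac' := vectorDensity_unique hint' hsing hsum
  refine ⟨hac', ?_⟩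
  rw [singPart, WithDensityᵥEq.congr_ae (show acDensity (blowUp c x₀ r μ) =ᵐ[volume] _ from hac'),
    sub_eq_iff_eq_add]
  exact hsum

theorem singVariation_blowUp {c : ℝ} (hc : 0 ≤ c) (x₀ : Space d) {r : ℝ} (hr : 0 < r)
    (μ : VectorMeasure (Space d) E) :
    singVariation (blowUp c x₀ r μ) =
      ENNReal.ofReal c • ((singVariation μ).restrict (cube x₀ r)).map (blowMap x₀ r) := by
  rw [singVariation, (acDensity_blowUp c x₀ hr μ).2, blowUp,
    VectorMeasure.variation_smul,
    VectorMeasure.variation_restrict isClosed_unitCube.measurableSet,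
    (measurableEmbedding_blowMap x₀ hr.ne').variation_map, restrict_map_blowMap _ x₀ hr]
  have : ENNReal.ofReal c = (‖c‖₊ : ENNReal) := by
    rw [← Real.enorm_of_nonneg hc]; rfl
  rw [this]
  rfl

/-- The positive factor c is absorbed entirely by the variation measure, so the polar density is
only transported. -/
theorem singDensity_blowUp {c : ℝ} (hc : 0 < c) (x₀ : Space d) {r : ℝ} (hr : 0 < r)
    (μ : VectorMeasure (Space d) E) :
    singDensity (blowUp c x₀ r μ) =ᵐ[singVariation (blowUp c x₀ r μ)]
      fun y => singDensity μ (x₀ + r • y) := by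
  have hQ : MeasurableSet (unitCube d) := isClosed_unitCube.measurableSet
  have hemb := measurableEmbedding_blowMap (d := d) x₀ hr.ne'
  have hfin : IsFiniteMeasure (singVariation μ) := isFiniteMeasure_variation _
  set h : Space d → E := fun y => singDensity μ (x₀ + r • y)
  have hcomp : h ∘ blowMap x₀ r = singDensity μ := by
    ext x; simp [h, blowMap_inverse x₀ hr.ne']
  have hsd : Integrable (singDensity μ) (singVariation μ) := integrable_vectorDensity _ _
  have hvar := singVariation_blowUp hc.le x₀ hr μ
  have hc0 : ENNReal.ofReal c ≠ 0 := by simpa using hc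
  have hint : Integrable h (singVariation (blowUp c x₀ r μ)) := by
    rw [hvar, integrable_smul_measure hc0 ENNReal.ofReal_ne_top, hemb.integrable_map_iff, hcomp]
    exact hsd.integrableOn
  have hrep : (singVariation μ).withDensityᵥ (singDensity μ) = singPart μ := by
    refine withDensity_vectorDensity_of_null fun s hs h0 => ?_
    have := VectorMeasure.enorm_measure_le_variation (singPart μ) s
    rw [show (singPart μ).variation s = 0 from h0] at this
    simpa using this
  refine vectorDensity_unique (t := 0) hint VectorMeasure.MutuallySingular.zero_left ?_
  rw [zero_add]
  ext1 s hs
  rw [(acDensity_blowUp c x₀ hr μ).2, blowUp_apply _ _ _ _ hs, withDensityᵥ_apply hint hs, hvar,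
    Measure.restrict_smul, integral_smul_measure, hemb.setIntegral_map,
    Measure.restrict_restrict (hemb.measurable hs), preimage_inter, preimage_blowMap_unitCube x₀ hr]
  conv_lhs => rw [← hrep]
  rw [withDensityᵥ_apply hsd ((hemb.measurable hs).inter (isClosed_cube x₀ r).measurableSet),
    ← hcomp, ENNReal.toReal_ofReal hc.le]
  rfl

end BlowUp

end

noncomputable section

/-! ### Compactified integrands and their representation by positive measures -/

section Lift

open scoped BoundedContinuousFunction

variable {d : ℕ} {E : Type*} [NormedAddCommGroup E] [InnerProductSpace ℝ E]

theorem continuous_toTorus : Continuous (toTorus (d := d)) := by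
  unfold toTorus
  exact continuous_pi fun k => (AddCircle.continuous_mk' 1).comp (by fun_prop)

theorem toTorus_sub (x y : Space d) : toTorus (x - y) = toTorus x - toTorus y := by
  ext k; simp [toTorus]

/-- The phase space carrying the compactified two-scale graphs. -/
abbrev Phase (d : ℕ) (E : Type*) := Space d × Torus d × E

/-- The radial compactification `z ↦ z / (1 + |z|)` of `E` onto its open unit ball. -/
def hat (z : E) : E := (1 + ‖z‖)⁻¹ • z

/-- The direction `z / |z|`. -/
def dir (z : E) : E := ‖z‖⁻¹ • z

theorem continuous_hat : Continuous (hat : E → E) := by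
  unfold hat
  refine Continuous.smul (Continuous.inv₀ (by fun_prop) fun z => ?_) continuous_id
  positivity

theorem norm_hat (z : E) : ‖hat z‖ = ‖z‖ / (1 + ‖z‖) := by
  have : 0 < 1 + ‖z‖ := by positivity
  rw [hat, norm_smul, norm_inv, Real.norm_of_nonneg this.le]
  field_simp

theorem norm_hat_lt_one (z : E) : ‖hat z‖ < 1 := by
  have : 0 < 1 + ‖z‖ := by positivity
  rw [norm_hat, div_lt_one this]
  linarith

theorem one_sub_norm_hat (z : E) : 1 - ‖hat z‖ = (1 + ‖z‖)⁻¹ := by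
  have : 0 < 1 + ‖z‖ := by positivity
  rw [norm_hat]; field_simp; ring

theorem unhat_hat (z : E) : (1 - ‖hat z‖)⁻¹ • hat z = z := by
  have : 0 < 1 + ‖z‖ := by positivity
  rw [one_sub_norm_hat, inv_inv, hat, smul_smul, mul_inv_cancel₀ this.ne', one_smul]

theorem one_add_norm_unhat {w : E} (hw : ‖w‖ < 1) :
    1 + ‖(1 - ‖w‖)⁻¹ • w‖ = (1 - ‖w‖)⁻¹ := by
  have : 0 < 1 - ‖w‖ := by linarith
  rw [norm_smul, norm_inv, Real.norm_of_nonneg this.le]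
  field_simp; ring

theorem hat_unhat {w : E} (hw : ‖w‖ < 1) : hat ((1 - ‖w‖)⁻¹ • w) = w := by
  have : 0 < 1 - ‖w‖ := by linarith
  rw [hat, one_add_norm_unhat hw, inv_inv, smul_smul, mul_inv_cancel₀ this.ne', one_smul]

theorem norm_dir_le (z : E) : ‖dir z‖ ≤ 1 := by
  rw [dir, norm_smul, norm_inv, norm_norm]
  exact inv_mul_le_one

theorem norm_dir {z : E} (hz : z ≠ 0) : ‖dir z‖ = 1 := by
  rw [dir, norm_smul, norm_inv, norm_norm]
  exact inv_mul_cancel₀ (norm_ne_zero_iff.2 hz)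

/-- The integrand whose compactification is `g`. -/
def integrandOf (g : Phase d E → ℝ) (x : Space d) (ξ : Torus d) (z : E) : ℝ :=
  (1 + ‖z‖) * g (x, ξ, hat z)

theorem isIntegrand_integrandOf (D : Set (Space d)) {g : Phase d E → ℝ} (hg : Continuous g) :
    IsIntegrand D (integrandOf g) where
  continuousOn := by
    refine Continuous.continuousOn ?_
    unfold integrandOf
    have := continuous_hat (E := E)
    fun_prop
  extends_continuously := by
    refine ⟨g, hg.continuousOn, fun x _ ξ z hz => ?_⟩
    have hz : ‖z‖ < 1 := by simpa using hz
    have : 0 < 1 - ‖z‖ := by linarith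
    rw [integrandOf, hat_unhat hz, one_add_norm_unhat hz, ← mul_assoc, mul_inv_cancel₀ this.ne',
      one_mul]

/-- For t > 0, f(x', ξ', tz)/t = (1/t + |z|) g(x', ξ', z/(1/t + |z|)), and g is continuous. For z =
0 the last argument is constantly 0, which agrees with `dir 0 = 0`. -/
theorem recession_eq {D : Set (Space d)} {f : Space d → Torus d → E → ℝ} {g : Phase d E → ℝ}
    (hg : Continuous g) (hfg : ∀ x ∈ D, ∀ ξ z, f x ξ z = integrandOf g x ξ z)
    {x : Space d} (hx : x ∈ closure D) (ξ : Torus d) (z : E) :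
    recession D f x ξ z = ‖z‖ * g (x, ξ, dir z) := by
  have : (𝓝[D] x).NeBot := mem_closure_iff_nhdsWithin_neBot.1 hx
  refine Tendsto.limUnder_eq ?_
  set F := 𝓝[D] x ×ˢ (𝓝 ξ ×ˢ (atTop : Filter ℝ))
  have hx' : Tendsto (fun p : Space d × Torus d × ℝ => p.1) F (𝓝 x) :=
    tendsto_fst.mono_right nhdsWithin_le_nhds
  have hξ' : Tendsto (fun p : Space d × Torus d × ℝ => p.2.1) F (𝓝 ξ) :=
    tendsto_fst.comp tendsto_snd
  have ht : Tendsto (fun p : Space d × Torus d × ℝ => p.2.2) F atTop :=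
    tendsto_snd.comp tendsto_snd
  have hti : Tendsto (fun p : Space d × Torus d × ℝ => p.2.2⁻¹) F (𝓝 0) :=
    tendsto_inv_atTop_zero.comp ht
  have hD : ∀ᶠ p : Space d × Torus d × ℝ in F, p.1 ∈ D :=
    tendsto_fst.eventually eventually_mem_nhdsWithin
  have hpos : ∀ᶠ p : Space d × Torus d × ℝ in F, 0 < p.2.2 := ht.eventually_gt_atTop 0
  have hw : Tendsto (fun p : Space d × Torus d × ℝ => (p.2.2⁻¹ + ‖z‖)⁻¹ • z) F (𝓝 (dir z)) := by
    by_cases hz : z = 0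
    · simp [hz, dir]
    · have : Tendsto (fun p : Space d × Torus d × ℝ => (p.2.2⁻¹ + ‖z‖)⁻¹) F (𝓝 ((0 + ‖z‖)⁻¹)) :=
        (hti.add_const _).inv₀ (by simpa using hz)
      simpa [dir] using this.smul_const z
  have hlim : Tendsto (fun p : Space d × Torus d × ℝ => (p.2.2⁻¹ + ‖z‖) *
      g (p.1, p.2.1, (p.2.2⁻¹ + ‖z‖)⁻¹ • z)) F (𝓝 ((0 + ‖z‖) * g (x, ξ, dir z))) :=
    (hti.add_const _).mul
      ((hg.tendsto _).comp (hx'.prodMk_nhds (hξ'.prodMk_nhds hw)))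
  rw [zero_add] at hlim
  refine hlim.congr' ?_
  filter_upwards [hD, hpos] with p hp ht
  rw [hfg _ hp, integrandOf]
  have h1 : hat (p.2.2 • z) = (p.2.2⁻¹ + ‖z‖)⁻¹ • z := by
    rw [hat, norm_smul, Real.norm_of_nonneg ht.le, smul_smul]
    congr 1
    field_simp
  rw [h1, norm_smul, Real.norm_of_nonneg ht.le]
  field_simp

/-- The closure of D × Z × ball is compact because D is bounded and E is finite-dimensional, so
Tietze extends the compactification of f to a bounded continuous function on the whole phase space.
-/
theorem IsIntegrand.exists_integrandOf [FiniteDimensional ℝ E] {D : Set (Space d)}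
    (hD : Bornology.IsBounded D) {f : Space d → Torus d → E → ℝ} (hf : IsIntegrand D f) :
    ∃ g : Phase d E →ᵇ ℝ, ∀ x ∈ D, ∀ ξ z, f x ξ z = integrandOf g x ξ z := by
  obtain ⟨g, hg, hgf⟩ := hf.extends_continuously
  set K := closure (D ×ˢ ((univ : Set (Torus d)) ×ˢ Metric.ball (0 : E) 1))
  have hK : IsCompact K := by
    refine Bornology.IsBounded.isCompact_closure ?_
    exact hD.prod (isCompact_univ.isBounded.prod Metric.isBounded_ball)
  have : CompactSpace K := isCompact_iff_compactSpace.1 hK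
  obtain ⟨G, -, hG⟩ := BoundedContinuousFunction.exists_norm_eq_domRestrict_eq_of_closed
    (BoundedContinuousFunction.mkOfCompact ⟨K.domRestrict g, hg.domRestrict⟩) hK.isClosed
  refine ⟨G, fun x hx ξ z => ?_⟩
  have hz : hat z ∈ Metric.ball (0 : E) 1 := by simpa using norm_hat_lt_one z
  have hmem : (x, ξ, hat z) ∈ K := subset_closure ⟨hx, mem_univ _, hz⟩
  have h1 : G (x, ξ, hat z) = g (x, ξ, hat z) := by
    exact DFunLike.congr_fun hG ⟨_, hmem⟩
  have : 0 < 1 + ‖z‖ := by positivity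
  rw [integrandOf, h1, hgf x hx ξ _ hz, unhat_hat, one_sub_norm_hat, ← mul_assoc,
    mul_inv_cancel₀ this.ne', one_mul]

variable [MeasurableSpace E] [BorelSpace E]

theorem measurable_dir [FiniteDimensional ℝ E] : Measurable (dir : E → E) := by
  unfold dir; fun_prop

variable {Y : Type*} [MeasurableSpace Y]

/-- The positive measure on the phase space which represents the action of integrands on the
`E`-valued oscillation density `h`. -/
def oscLift (m : Measure Y) (p : Y → Space d × Torus d) (h : Y → E) : Measure (Phase d E) :=
  (m.withDensity fun y => ENNReal.ofReal (1 + ‖h y‖)).map fun y => ((p y).1, (p y).2, hat (h y))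

/-- The positive measure on the phase space which represents the action of recession functions on
the `E`-valued density `h`. -/
def concLift (m : Measure Y) (p : Y → Space d × Torus d) (h : Y → E) : Measure (Phase d E) :=
  (m.withDensity fun y => ENNReal.ofReal ‖h y‖).map fun y => ((p y).1, (p y).2, dir (h y))

variable {m : Measure Y} {p : Y → Space d × Torus d} {h : Y → E}

theorem isFiniteMeasure_oscLift [IsFiniteMeasure m] (hi : Integrable h m) :
    IsFiniteMeasure (oscLift m p h) := by
  have : IsFiniteMeasure (m.withDensity fun y => ENNReal.ofReal (1 + ‖h y‖)) :=
    isFiniteMeasure_withDensity_ofReal ((integrable_const (1 : ℝ)).add hi.norm).2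
  unfold oscLift; infer_instance

theorem isFiniteMeasure_concLift (hi : Integrable h m) :
    IsFiniteMeasure (concLift m p h) := by
  have : IsFiniteMeasure (m.withDensity fun y => ENNReal.ofReal ‖h y‖) :=
    isFiniteMeasure_withDensity_ofReal hi.norm.2
  unfold concLift; infer_instance

variable [FiniteDimensional ℝ E]

theorem integral_oscLift (hp : Measurable p) (hh : Measurable h) {g : Phase d E → ℝ}
    (hg : Measurable g) :
    ∫ q, g q ∂(oscLift m p h) = ∫ y, (1 + ‖h y‖) * g ((p y).1, (p y).2, hat (h y)) ∂m := by
  have := continuous_hat (E := E)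
  rw [oscLift, integral_map (by fun_prop) hg.aestronglyMeasurable,
    integral_withDensity_eq_integral_toReal_smul (by fun_prop) (by simp)]
  refine integral_congr_ae (ae_of_all _ fun y => ?_)
  simp only [smul_eq_mul]
  rw [ENNReal.toReal_ofReal (by positivity)]

theorem integral_concLift (hp : Measurable p) (hh : Measurable h) {g : Phase d E → ℝ}
    (hg : Measurable g) :
    ∫ q, g q ∂(concLift m p h) = ∫ y, ‖h y‖ * g ((p y).1, (p y).2, dir (h y)) ∂m := by
  have := measurable_dir (E := E)
  rw [concLift, integral_map (by fun_prop) hg.aestronglyMeasurable,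
    integral_withDensity_eq_integral_toReal_smul (by fun_prop) (by simp)]
  refine integral_congr_ae (ae_of_all _ fun y => ?_)
  simp only [smul_eq_mul]
  rw [ENNReal.toReal_ofReal (by positivity)]

theorem oscLift_null (hp : Measurable p) (hh : Measurable h) {s : Set (Space d)}
    (hs : MeasurableSet s) (hm : ∀ᵐ y ∂m, (p y).1 ∈ s) :
    ∀ᵐ q ∂(oscLift m p h), q.1 ∈ s ∧ ‖q.2.2‖ ≤ 1 := by
  have := continuous_hat (E := E)
  rw [oscLift, ae_map_iff (by fun_prop)]
  · refine (withDensity_absolutelyContinuous _ _).ae_le ?_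
    filter_upwards [hm] with y hy using ⟨hy, (norm_hat_lt_one _).le⟩
  · exact (measurable_fst hs).inter (measurableSet_le (measurable_snd.snd.norm) measurable_const)

theorem concLift_null (hp : Measurable p) (hh : Measurable h) {s : Set (Space d)}
    (hs : MeasurableSet s) (hm : ∀ᵐ y ∂m, (p y).1 ∈ s) :
    ∀ᵐ q ∂(concLift m p h), q.1 ∈ s ∧ ‖q.2.2‖ ≤ 1 := by
  have := measurable_dir (E := E)
  rw [concLift, ae_map_iff (by fun_prop)]
  · refine (withDensity_absolutelyContinuous _ _).ae_le ?_
    filter_upwards [hm] with y hy using ⟨hy, norm_dir_le _⟩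
  · exact (measurable_fst hs).inter (measurableSet_le (measurable_snd.snd.norm) measurable_const)

/-- The positive measure on the phase space representing `f ↦ I^ε_f(μ)`. -/
def functionalLift (D : Set (Space d)) (ε : ℝ) (μ : VectorMeasure (Space d) E) :
    Measure (Phase d E) :=
  oscLift (volume.restrict D) (fun x => (x, toTorus (ε⁻¹ • x))) (acDensity μ) +
    concLift ((singVariation μ).restrict D) (fun x => (x, toTorus (ε⁻¹ • x))) (singDensity μ)

theorem measurable_scale (ε : ℝ) :
    Measurable fun x : Space d => (x, toTorus (ε⁻¹ • x)) := by
  have := continuous_toTorus (d := d)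
  fun_prop

theorem isFiniteMeasure_functionalLift {D : Set (Space d)} (hD : Bornology.IsBounded D)
    (ε : ℝ) (μ : VectorMeasure (Space d) E) : IsFiniteMeasure (functionalLift D ε μ) := by
  have : IsFiniteMeasure (volume.restrict D) := ⟨by simpa using hD.measure_lt_top⟩
  have h1 : IsFiniteMeasure (oscLift (volume.restrict D)
      (fun x : Space d => (x, toTorus (ε⁻¹ • x))) (acDensity μ)) :=
    isFiniteMeasure_oscLift (integrable_vectorDensity _ _).integrableOn
  have h2 : IsFiniteMeasure (concLift ((singVariation μ).restrict D)
      (fun x : Space d => (x, toTorus (ε⁻¹ • x))) (singDensity μ)) :=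
    isFiniteMeasure_concLift (integrable_vectorDensity _ _).integrableOn
  unfold functionalLift; infer_instance

theorem integral_functionalLift {D : Set (Space d)} (hD : Bornology.IsBounded D)
    (ε : ℝ) (μ : VectorMeasure (Space d) E) {g : Phase d E → ℝ} (hg : Measurable g) {C : ℝ}
    (hgC : ∀ q, |g q| ≤ C) :
    ∫ q, g q ∂(functionalLift D ε μ) =
      (∫ x in D, (1 + ‖acDensity μ x‖) * g (x, toTorus (ε⁻¹ • x), hat (acDensity μ x))) +
      ∫ x in D, ‖singDensity μ x‖ * g (x, toTorus (ε⁻¹ • x), dir (singDensity μ x))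
        ∂(singVariation μ) := by
  have hfin := isFiniteMeasure_functionalLift hD ε μ
  have hac : Measurable (acDensity μ) := measurable_vectorDensity _ _
  have hsd : Measurable (singDensity μ) := measurable_vectorDensity _ _
  have hint : Integrable g (functionalLift D ε μ) :=
    .of_bound hg.aestronglyMeasurable C (ae_of_all _ hgC)
  rw [functionalLift, integrable_add_measure] at hint
  rw [functionalLift, integral_add_measure hint.1 hint.2,
    integral_oscLift (measurable_scale ε) hac hg, integral_concLift (measurable_scale ε) hsd hg]

theorem twoScaleFunctional_eq_integral {D : Set (Space d)} (hD : Bornology.IsBounded D)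
    (hDm : MeasurableSet D) {f : Space d → Torus d → E → ℝ} {g : Phase d E →ᵇ ℝ}
    (hfg : ∀ x ∈ D, ∀ ξ z, f x ξ z = integrandOf g x ξ z) (ε : ℝ)
    (μ : VectorMeasure (Space d) E) :
    twoScaleFunctional D f ε μ = ∫ q, g q ∂(functionalLift D ε μ) := by
  rw [integral_functionalLift hD ε μ g.continuous.measurable g.norm_coe_le_norm,
    twoScaleFunctional]
  congr 1
  · exact setIntegral_congr_fun hDm fun x hx => hfg x hx _ _
  · exact setIntegral_congr_fun hDm fun x hx =>
      recession_eq g.continuous hfg (subset_closure hx) _ _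

/-- Concentration on the closed unit ball in the last variable is what allows uniform estimates over
a compact set in `generates_blow`. -/
theorem functionalLift_null {D : Set (Space d)} (hDm : MeasurableSet D) (ε : ℝ)
    (μ : VectorMeasure (Space d) E) :
    ∀ᵐ q ∂(functionalLift D ε μ), q.1 ∈ D ∧ ‖q.2.2‖ ≤ 1 := by
  rw [functionalLift, ae_add_measure_iff]
  exact ⟨oscLift_null (measurable_scale ε) (measurable_vectorDensity _ _) hDm
      (ae_restrict_mem hDm),
    concLift_null (measurable_scale ε) (measurable_vectorDensity _ _) hDm (ae_restrict_mem hDm)⟩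

end Lift

end

noncomputable section

/-! ### Young measures as Markov kernels, and generation as weak convergence -/

section YoungKernels

open ProbabilityTheory
open scoped BoundedContinuousFunction

variable {d : ℕ} {E : Type*} [NormedAddCommGroup E] [InnerProductSpace ℝ E] [MeasurableSpace E]

/-- Take a measurable version and replace it by a fixed Dirac mass wherever its total mass is not 1.
-/
theorem exists_kernel_ae_eq {α β : Type*} [MeasurableSpace α] [MeasurableSpace β] [Nonempty β]
    {m : Measure α} {f : α → Measure β} (hf : AEMeasurable f m)
    (hp : ∀ᵐ a ∂m, IsProbabilityMeasure (f a)) :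
    ∃ κ : Kernel α β, IsMarkovKernel κ ∧ ∀ᵐ a ∂m, f a = κ a := by
  classical
  have hs : MeasurableSet {a | hf.mk f a univ = 1} :=
    (Measure.measurable_coe MeasurableSet.univ).comp hf.measurable_mk (measurableSet_singleton 1)
  let b : β := Classical.arbitrary β
  refine ⟨⟨fun a => if hf.mk f a univ = 1 then hf.mk f a else Measure.dirac b,
    Measurable.ite hs hf.measurable_mk measurable_const⟩, ⟨fun a => ?_⟩, ?_⟩
  · by_cases h : hf.mk f a univ = 1
    · simpa [h] using ⟨h⟩
    · simp only [Kernel.coe_mk, h, if_false]; infer_instance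
  · filter_upwards [hf.ae_eq_mk, hp] with a ha hpa
    have h : hf.mk f a univ = 1 := by rw [← ha]; exact hpa.measure_univ
    simp [h, ha]

theorem integrable_integral_compProd {α β : Type*} [MeasurableSpace α] [MeasurableSpace β]
    {m : Measure α} [SFinite m] {κ : Kernel α β} [IsSFiniteKernel κ] {f : α × β → ℝ}
    (hf : Integrable f (m ⊗ₘ κ)) : Integrable (fun a => ∫ b, f (a, b) ∂κ a) m := by
  simpa using Integrable.integral_compProd (κ := Kernel.const Unit m)
    (η := Kernel.prodMkLeft Unit κ) (a := ()) hf

theorem semiProd_kernel {X Y : Type*} [MeasurableSpace X] [MeasurableSpace Y] (lam : Measure X)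
    [SFinite lam] (κ : Kernel X Y) [IsSFiniteKernel κ] :
    semiProd lam (fun x => κ x) = lam ⊗ₘ κ := by
  rw [Measure.compProd_eq_comp_prod, semiProd]
  congr 1
  ext1 x
  rw [Kernel.prod_apply, Kernel.id_apply, Measure.dirac_prod]

theorem semiProd_congr {X Y : Type*} [MeasurableSpace X] [MeasurableSpace Y] {lam : Measure X}
    {ρ ρ' : X → Measure Y} (h : ∀ᵐ x ∂lam, ρ x = ρ' x) : semiProd lam ρ = semiProd lam ρ' :=
  Measure.bind_congr_right (h.mono fun x hx => by simp only [hx])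

/-- A two-scale* Young measure whose disintegrations are honest Markov kernels. -/
structure YoungKernels (D : Set (Space d)) (E : Type*) [NormedAddCommGroup E]
    [InnerProductSpace ℝ E] [MeasurableSpace E] where
  osc : Kernel (Space d × Torus d) E
  lam : Measure (Space d)
  rho : Kernel (Space d) (Torus d)
  conc : Kernel (Space d × Torus d) (Metric.sphere (0 : E) 1)
  osc_markov : IsMarkovKernel osc
  lam_finite : IsFiniteMeasure lam
  rho_markov : IsMarkovKernel rho
  conc_markov : IsMarkovKernel conc
  lam_support : lam (closure D)ᶜ = 0
  osc_moment : ∫⁻ p : Space d × Torus d, (∫⁻ z, ‖z‖ₑ ∂(osc p))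
    ∂((volume.restrict (closure D)).prod volume) < ⊤

attribute [instance] YoungKernels.osc_markov YoungKernels.lam_finite YoungKernels.rho_markov
  YoungKernels.conc_markov

namespace YoungKernels

variable {D : Set (Space d)} (N : YoungKernels D E)

/-- The joint measure of position, microscopic position and oscillation values. -/
def oscMeasure : Measure ((Space d × Torus d) × E) :=
  ((volume.restrict (closure D)).prod volume) ⊗ₘ N.osc

/-- The joint measure of position, microscopic position and concentration directions. -/
def concMeasure : Measure ((Space d × Torus d) × Metric.sphere (0 : E) 1) :=
  (N.lam ⊗ₘ N.rho) ⊗ₘ N.conc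

/-- The positive measure on the phase space representing the duality pairing. -/
def lift : Measure (Phase d E) :=
  oscLift N.oscMeasure Prod.fst Prod.snd +
    concLift N.concMeasure Prod.fst fun q => (q.2 : E)

instance : IsFiniteMeasure N.concMeasure := by unfold concMeasure; infer_instance

theorem isFiniteMeasure_oscMeasure (hD : Bornology.IsBounded D) :
    IsFiniteMeasure N.oscMeasure := by
  have : IsFiniteMeasure (volume.restrict (closure D)) :=
    ⟨by simpa using hD.closure.measure_lt_top⟩
  unfold oscMeasure; infer_instance

/-- The Young measure given by the kernels. -/
def toYoung : TwoScaleYoungMeasure D E where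
  osc x ξ := N.osc (x, ξ)
  lam := N.lam
  rho x := N.rho x
  conc x ξ := N.conc (x, ξ)
  osc_measurable := N.osc.measurable.aemeasurable
  osc_prob := ae_of_all _ fun p => N.osc_markov.isProbabilityMeasure p
  osc_moment := N.osc_moment
  lam_finite := N.lam_finite
  lam_support := N.lam_support
  rho_measurable := N.rho.measurable.aemeasurable
  rho_prob := ae_of_all _ fun p => N.rho_markov.isProbabilityMeasure p
  conc_measurable := N.conc.measurable.aemeasurable
  conc_prob := ae_of_all _ fun p => N.conc_markov.isProbabilityMeasure p

/-- The kernels agree almost everywhere with the components of the Young measure. -/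
structure Represents (ν : TwoScaleYoungMeasure D E) : Prop where
  lam_eq : ν.lam = N.lam
  osc_ae : ∀ᵐ p : Space d × Torus d ∂((volume.restrict (closure D)).prod volume),
    ν.osc p.1 p.2 = N.osc p
  rho_ae : ∀ᵐ x ∂N.lam, ν.rho x = N.rho x
  conc_ae : ∀ᵐ p : Space d × Torus d ∂(N.lam ⊗ₘ N.rho), ν.conc p.1 p.2 = N.conc p

theorem represents_toYoung : N.Represents N.toYoung where
  lam_eq := rfl
  osc_ae := ae_of_all _ fun _ => rfl
  rho_ae := ae_of_all _ fun _ => rfl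
  conc_ae := ae_of_all _ fun _ => rfl

theorem exists_represents [Nonempty (Metric.sphere (0 : E) 1)] (ν : TwoScaleYoungMeasure D E) :
    ∃ N : YoungKernels D E, N.Represents ν := by
  have := ν.lam_finite
  obtain ⟨κo, hκo, ho⟩ := exists_kernel_ae_eq ν.osc_measurable ν.osc_prob
  obtain ⟨κr, hκr, hr⟩ := exists_kernel_ae_eq ν.rho_measurable ν.rho_prob
  obtain ⟨κc, hκc, hc⟩ := exists_kernel_ae_eq ν.conc_measurable ν.conc_prob
  rw [semiProd_congr hr, semiProd_kernel] at hc
  refine ⟨⟨κo, ν.lam, κr, κc, hκo, ν.lam_finite, hκr, hκc, ν.lam_support, ?_⟩, rfl, ho, hr, hc⟩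
  refine lt_of_eq_of_lt (lintegral_congr_ae ?_) ν.osc_moment
  filter_upwards [ho] with p hp
  rw [hp]

variable [BorelSpace E] [FiniteDimensional ℝ E]

theorem integrable_snd_oscMeasure : Integrable Prod.snd N.oscMeasure := by
  refine ⟨measurable_snd.aestronglyMeasurable, ?_⟩
  rw [HasFiniteIntegral, oscMeasure, Measure.lintegral_compProd (by fun_prop)]
  exact N.osc_moment

theorem integrable_coe_concMeasure :
    Integrable (fun q => (q.2 : E)) N.concMeasure := by
  refine .of_bound (by fun_prop) 1 (ae_of_all _ fun q => ?_)
  simp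

theorem isFiniteMeasure_lift (hD : Bornology.IsBounded D) : IsFiniteMeasure N.lift := by
  have := N.isFiniteMeasure_oscMeasure hD
  have h1 : IsFiniteMeasure (oscLift N.oscMeasure Prod.fst Prod.snd) :=
    isFiniteMeasure_oscLift N.integrable_snd_oscMeasure
  have h2 : IsFiniteMeasure (concLift N.concMeasure Prod.fst fun q => (q.2 : E)) :=
    isFiniteMeasure_concLift N.integrable_coe_concMeasure
  unfold lift; infer_instance

theorem norm_coe_sphere (z : Metric.sphere (0 : E) 1) : ‖(z : E)‖ = 1 := by simp

theorem dir_coe_sphere (z : Metric.sphere (0 : E) 1) : dir (z : E) = z := by simp [dir]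

theorem integral_lift (hD : Bornology.IsBounded D) {g : Phase d E → ℝ} (hg : Measurable g)
    {C : ℝ} (hgC : ∀ q, |g q| ≤ C) :
    ∫ q, g q ∂N.lift =
      (∫ q, (1 + ‖q.2‖) * g (q.1.1, q.1.2, hat q.2) ∂N.oscMeasure) +
      ∫ q, g (q.1.1, q.1.2, (q.2 : E)) ∂N.concMeasure := by
  have hfin := N.isFiniteMeasure_lift hD
  have hint : Integrable g N.lift :=
    .of_bound hg.aestronglyMeasurable C (ae_of_all _ hgC)
  rw [lift, integrable_add_measure] at hint
  rw [lift, integral_add_measure hint.1 hint.2,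
    integral_oscLift measurable_fst measurable_snd hg,
    integral_concLift measurable_fst (by fun_prop) hg]
  simp only [norm_coe_sphere, dir_coe_sphere, one_mul]

theorem youngPairing_eq_integral_lift {ν : TwoScaleYoungMeasure D E} (hN : N.Represents ν)
    (hD : Bornology.IsBounded D) (hDm : MeasurableSet D) (hD0 : volume (closure D \ D) = 0)
    {f : Space d → Torus d → E → ℝ} {g : Phase d E →ᵇ ℝ}
    (hfg : ∀ x ∈ D, ∀ ξ z, f x ξ z = integrandOf g x ξ z) :
    youngPairing f ν = ∫ q, g q ∂N.lift := by
  have hg := g.continuous.measurable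
  have hhat := continuous_hat (E := E)
  have hfino := N.isFiniteMeasure_oscMeasure hD
  rw [N.integral_lift hD hg g.norm_coe_le_norm, youngPairing]
  -- The pairing integrates oscillations over D while `oscMeasure` lives over its closure; the
  -- difference is Lebesgue null.
  have hres : (volume : Measure (Space d)).restrict D = volume.restrict (closure D) :=
    Measure.restrict_congr_set (subset_closure.eventuallyLE.antisymm
      (ae_le_set.2 hD0))
  congr 1
  · have hint : Integrable (fun q : (Space d × Torus d) × E =>
        (1 + ‖q.2‖) * g (q.1.1, q.1.2, hat q.2)) N.oscMeasure := by
      refine Integrable.mul_bdd (c := ‖g‖)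
        ((integrable_const (1 : ℝ)).add N.integrable_snd_oscMeasure.norm) (by fun_prop)
        (ae_of_all _ fun q => g.norm_coe_le_norm _)
    rw [oscMeasure] at hint ⊢
    have : IsFiniteMeasure (volume.restrict (closure D)) :=
      ⟨by simpa using hD.closure.measure_lt_top⟩
    rw [Measure.integral_compProd hint, integral_prod _ (integrable_integral_compProd hint)]
    have h1 := Measure.ae_ae_of_ae_prod hN.osc_ae
    rw [← hres] at h1 ⊢
    refine integral_congr_ae ?_
    filter_upwards [h1, ae_restrict_mem hDm] with x hx hxD
    refine integral_congr_ae ?_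
    filter_upwards [hx] with ξ hξ
    rw [hξ]
    exact integral_congr_ae (ae_of_all _ fun z => hfg x hxD ξ z)
  · have hint : Integrable (fun q : (Space d × Torus d) × Metric.sphere (0 : E) 1 =>
        g (q.1.1, q.1.2, (q.2 : E))) N.concMeasure :=
      .of_bound (by fun_prop) ‖g‖ (ae_of_all _ fun q => g.norm_coe_le_norm _)
    rw [concMeasure] at hint ⊢
    rw [Measure.integral_compProd hint, Measure.integral_compProd (integrable_integral_compProd hint),
      hN.lam_eq, Measure.restrict_eq_self_of_ae_mem
        (show ∀ᵐ x ∂N.lam, x ∈ closure D from N.lam_support)]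
    refine integral_congr_ae ?_
    filter_upwards [hN.rho_ae, Measure.ae_ae_of_ae_compProd hN.conc_ae,
      (show ∀ᵐ x ∂N.lam, x ∈ closure D from N.lam_support)] with x hρ hc hx
    rw [hρ]
    refine integral_congr_ae ?_
    filter_upwards [hc] with ξ hξ
    rw [hξ]
    refine integral_congr_ae (ae_of_all _ fun z => ?_)
    simp only
    rw [recession_eq g.continuous hfg hx, norm_coe_sphere, one_mul, dir_coe_sphere]

end YoungKernels

/-- Every bounded continuous g is the compactification of an integrand, and every integrand on D
arises from such a g, so testing with either class is equivalent. -/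
theorem generates_iff {D : Set (Space d)} [BorelSpace E] [FiniteDimensional ℝ E]
    {ν : TwoScaleYoungMeasure D E} {N : YoungKernels D E} (hN : N.Represents ν)
    (hD : Bornology.IsBounded D) (hDm : MeasurableSet D) (hD0 : volume (closure D \ D) = 0)
    {ε : ℕ → ℝ} {μ : ℕ → VectorMeasure (Space d) E} :
    Generates ε μ ν ↔ (∀ i, 0 < ε i) ∧ Tendsto ε atTop (𝓝 0) ∧ (∀ i, (μ i).restrict D = μ i) ∧
      ∀ g : Phase d E →ᵇ ℝ, Tendsto (fun i => ∫ q, g q ∂(functionalLift D (ε i) (μ i))) atTop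
        (𝓝 (∫ q, g q ∂N.lift)) := by
  constructor
  · rintro ⟨h1, h2, h3, h4⟩
    refine ⟨h1, h2, h3, fun g => ?_⟩
    have := h4 _ (isIntegrand_integrandOf D g.continuous)
    simpa only [N.youngPairing_eq_integral_lift hN hD hDm hD0 (g := g) fun _ _ _ _ => rfl,
      twoScaleFunctional_eq_integral hD hDm (g := g) fun _ _ _ _ => rfl] using this
  · rintro ⟨h1, h2, h3, h4⟩
    refine ⟨h1, h2, h3, fun f hf => ?_⟩
    obtain ⟨g, hg⟩ := hf.exists_integrandOf hD
    simpa only [N.youngPairing_eq_integral_lift hN hD hDm hD0 hg,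
      twoScaleFunctional_eq_integral hD hDm hg] using h4 g

theorem weakStarTendsto_of_lift {D : Set (Space d)} [BorelSpace E] [FiniteDimensional ℝ E]
    {N : ℕ → YoungKernels D E} {M : YoungKernels D E}
    (hD : Bornology.IsBounded D) (hDm : MeasurableSet D) (hD0 : volume (closure D \ D) = 0)
    (h : ∀ g : Phase d E →ᵇ ℝ, Tendsto (fun j => ∫ q, g q ∂(N j).lift) atTop
      (𝓝 (∫ q, g q ∂M.lift))) :
    WeakStarTendsto (fun j => (N j).toYoung) M.toYoung := by
  intro f hf
  obtain ⟨g, hg⟩ := hf.exists_integrandOf hD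
  rw [M.youngPairing_eq_integral_lift M.represents_toYoung hD hDm hD0 hg]
  simpa only [fun j => (N j).youngPairing_eq_integral_lift (N j).represents_toYoung hD hDm hD0 hg]
    using h g

end YoungKernels

end

noncomputable section

/-! ### Localization and diagonal sequences for weak convergence -/

section WeakConvergence

open scoped BoundedContinuousFunction NNReal ENNReal

/-- A cut-off θ equals 1 on the frontier and has small `M₀`-integral. Then (1 - θ)g restricted to s
is continuous, since it vanishes on the frontier, and the error is at most ‖g‖ ∫ θ, which is
eventually small for `M i` too. -/
theorem tendsto_setIntegral_of_frontier_null {X : Type*} [PseudoEMetricSpace X]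
    [MeasurableSpace X] [BorelSpace X] {M : ℕ → Measure X} {M₀ : Measure X}
    [∀ i, IsFiniteMeasure (M i)] [IsFiniteMeasure M₀]
    (h : ∀ g : X →ᵇ ℝ, Tendsto (fun i => ∫ x, g x ∂M i) atTop (𝓝 (∫ x, g x ∂M₀)))
    {s : Set X} (hs : MeasurableSet s) (h0 : M₀ (frontier s) = 0) (g : X →ᵇ ℝ) :
    Tendsto (fun i => ∫ x in s, g x ∂M i) atTop (𝓝 (∫ x in s, g x ∂M₀)) := by
  rw [Metric.tendsto_atTop]
  intro ε hε
  -- The cut-off costs ‖g‖δ once for `M i` and once for `M₀`, and the convergence of the integrals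
  -- of `φ` costs δ. The summand 2 leaves room and avoids a zero denominator when g = 0.
  set δ : ℝ := ε / (2 * ‖g‖ + 2) with hδ
  have hg0 : 0 ≤ ‖g‖ := norm_nonneg g
  have hδ0 : 0 < δ := by positivity
  obtain ⟨θ, hθ1, hθs, hθ⟩ : ∃ θ : X →ᵇ ℝ, (∀ x, 0 ≤ θ x ∧ θ x ≤ 1) ∧
      (∀ x ∈ frontier s, θ x = 1) ∧ ∫ x, θ x ∂M₀ < δ := by
    have hpos : ∀ n : ℕ, 0 < 1 / ((n : ℝ) + 1) := fun n => Nat.one_div_pos_of_nat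
    have hl := tendsto_lintegral_thickenedIndicator_of_isClosed M₀ (F := frontier s)
      isClosed_frontier hpos tendsto_one_div_add_atTop_nhds_zero_nat
    rw [h0] at hl
    obtain ⟨n, hn⟩ := (hl.eventually_lt_const
      (show (0 : ℝ≥0∞) < ENNReal.ofReal δ by simpa using hδ0)).exists
    refine ⟨(thickenedIndicator (hpos n) (frontier s)).comp (fun t : ℝ≥0 => (t : ℝ))
      NNReal.isometry_coe.lipschitz, fun x => ⟨NNReal.coe_nonneg _, ?_⟩, fun x hx => ?_, ?_⟩
    · exact_mod_cast thickenedIndicator_le_one (hpos n) (frontier s) x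
    · have := thickenedIndicator_one (hpos n) (frontier s) hx
      change ((thickenedIndicator (hpos n) (frontier s) x : ℝ≥0) : ℝ) = 1
      rw [this]; rfl
    · rw [lintegral_coe_eq_integral _ (integrable_thickenedIndicator _ _),
        ENNReal.ofReal_lt_ofReal_iff hδ0] at hn
      exact hn
  have hint : ∀ (m : Measure X) [IsFiniteMeasure m] (f : X →ᵇ ℝ), Integrable f m :=
    fun m _ f => f.integrable m
  let φ : X →ᵇ ℝ := BoundedContinuousFunction.ofNormedAddCommGroup
    (s.indicator fun x => (1 - θ x) * g x)
    (continuous_indicator (fun x hx => by simp [hθs x hx]) (by fun_prop)) ‖g‖ (fun x => by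
      by_cases hx : x ∈ s
      · rw [indicator_of_mem hx, norm_mul]
        have : ‖1 - θ x‖ ≤ 1 := by
          rw [Real.norm_eq_abs, abs_le]
          constructor <;> linarith [(hθ1 x).1, (hθ1 x).2]
        calc _ ≤ 1 * ‖g‖ := by gcongr; exact g.norm_coe_le_norm x
          _ = _ := one_mul _
      · simp [indicator_of_notMem hx])
  have key : ∀ (m : Measure X) [IsFiniteMeasure m],
      |∫ x in s, g x ∂m - ∫ x, φ x ∂m| ≤ ‖g‖ * ∫ x, θ x ∂m := by
    intro m _
    have h1 : ∫ x, φ x ∂m = ∫ x in s, (1 - θ x) * g x ∂m := integral_indicator hs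
    have hi2 : Integrable (fun x => (1 - θ x) * g x) m := by
      exact hint m ((1 - θ) * g)
    have hi3 : Integrable (fun x => θ x * g x) m := by
      exact hint m (θ * g)
    rw [h1, ← integral_sub (hint m g).integrableOn hi2.integrableOn]
    calc _ ≤ ∫ x in s, |g x - (1 - θ x) * g x| ∂m := abs_integral_le_integral_abs
      _ ≤ ∫ x in s, ‖g‖ * θ x ∂m := by
          refine integral_mono ?_ ((hint m θ).const_mul _).integrableOn fun x => ?_
          · exact (((hint m g).sub hi2).abs).integrableOn
          · have : g x - (1 - θ x) * g x = g x * θ x := by ring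
            simp only [this, abs_mul, abs_of_nonneg (hθ1 x).1]
            exact mul_le_mul_of_nonneg_right (g.norm_coe_le_norm x) (hθ1 x).1
      _ ≤ ∫ x, ‖g‖ * θ x ∂m := setIntegral_le_integral ((hint m θ).const_mul _)
            (ae_of_all _ fun x => mul_nonneg hg0 (hθ1 x).1)
      _ = _ := integral_const_mul _ _
  have e1 := (h θ).eventually_lt_const hθ
  have e2 := Metric.tendsto_atTop.1 (h φ) δ hδ0
  obtain ⟨n1, e1⟩ := eventually_atTop.1 e1
  obtain ⟨n2, e2⟩ := e2
  refine ⟨max n1 n2, fun i hi => ?_⟩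
  have f1 := e1 i (le_trans (le_max_left _ _) hi)
  have f2 := e2 i (le_trans (le_max_right _ _) hi)
  have k1 := key (M i)
  have k2 := key M₀
  rw [Real.dist_eq] at f2 ⊢
  have k1' : ‖g‖ * ∫ x, θ x ∂(M i) ≤ ‖g‖ * δ := by gcongr
  have k2' : ‖g‖ * ∫ x, θ x ∂M₀ ≤ ‖g‖ * δ := by gcongr
  have hδε : 2 * (‖g‖ * δ) + 2 * δ = ε := by rw [hδ]; field_simp
  rw [abs_le] at k1 k2
  rw [abs_lt] at f2 ⊢
  constructor <;> linarith [f2.1, f2.2, k1.1, k1.2, k2.1, k2.2]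

theorem tendsto_setIntegral_of_uniform {X : Type*} [PseudoEMetricSpace X]
    [MeasurableSpace X] [BorelSpace X] {M : ℕ → Measure X} {M₀ : Measure X}
    [∀ i, IsFiniteMeasure (M i)] [IsFiniteMeasure M₀]
    (h : ∀ g : X →ᵇ ℝ, Tendsto (fun i => ∫ x, g x ∂M i) atTop (𝓝 (∫ x, g x ∂M₀)))
    {s : Set X} (hs : MeasurableSet s) (h0 : M₀ (frontier s) = 0) {g : ℕ → X →ᵇ ℝ} {g₀ : X →ᵇ ℝ}
    (hg : ∀ δ > 0, ∀ᶠ i in atTop, ∀ᵐ x ∂M i, x ∈ s → |g i x - g₀ x| ≤ δ) :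
    Tendsto (fun i => ∫ x in s, g i x ∂M i) atTop (𝓝 (∫ x in s, g₀ x ∂M₀)) := by
  have h1 := tendsto_setIntegral_of_frontier_null h hs h0 g₀
  suffices h2 : Tendsto (fun i => ∫ x in s, g i x ∂M i - ∫ x in s, g₀ x ∂M i) atTop (𝓝 0) by
    simpa using h2.add h1
  -- Testing with 1 bounds the masses eventually, so a uniformly small change of the test function
  -- is harmless.
  have hm : Tendsto (fun i => (M i).real univ) atTop (𝓝 (M₀.real univ)) := by
    simpa using h (BoundedContinuousFunction.const X 1)
  rw [Metric.tendsto_atTop]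
  intro ε hε
  set B := M₀.real univ + 1
  have hB : 0 < B := by positivity
  have e1 := hm.eventually_lt_const (show M₀.real univ < B by simp [B])
  have e2 := hg (ε / (2 * B)) (by positivity)
  refine eventually_atTop.1 ?_
  filter_upwards [e1, e2] with i hi1 hi2
  rw [Real.dist_eq, sub_zero, ← integral_sub ((g i).integrable _) (g₀.integrable _)]
  have h3 : ∀ᵐ x ∂(M i).restrict s, ‖g i x - g₀ x‖ ≤ ε / (2 * B) := by
    rw [ae_restrict_iff' hs]; exact hi2
  calc _ ≤ ε / (2 * B) * ((M i).restrict s).real univ := norm_integral_le_of_norm_le_const h3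
    _ ≤ ε / (2 * B) * B := by
        gcongr
        refine le_trans ?_ hi1.le
        rw [measureReal_restrict_apply_univ]
        exact measureReal_mono (subset_univ _)
    _ < ε := by
        field_simp; linarith

/-- Probability measures on a separable pseudo-metrizable space are pseudo-metrizable. Mapping a
finite measure to its normalization and mass therefore provides distances for the diagonal choice.
Normalization is continuous only away from 0, hence the assumptions that the limits are nonzero. -/
theorem exists_diagonal_weak {X : Type*} [TopologicalSpace X]
    [TopologicalSpace.PseudoMetrizableSpace X] [TopologicalSpace.SeparableSpace X] [Nonempty X]
    [MeasurableSpace X] [BorelSpace X] {u : ℕ → ℕ → Measure X} {v : ℕ → Measure X} {w : Measure X}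
    [hu : ∀ j n, IsFiniteMeasure (u j n)] [hv : ∀ j, IsFiniteMeasure (v j)] [hw : IsFiniteMeasure w]
    (hv0 : ∀ j, v j ≠ 0) (hw0 : w ≠ 0)
    (huv : ∀ j, ∀ g : X →ᵇ ℝ, Tendsto (fun n => ∫ x, g x ∂u j n) atTop (𝓝 (∫ x, g x ∂v j)))
    (hvw : ∀ g : X →ᵇ ℝ, Tendsto (fun j => ∫ x, g x ∂v j) atTop (𝓝 (∫ x, g x ∂w)))
    {P : ℕ → ℕ → Prop} (hP : ∀ j, ∀ᶠ n in atTop, P j n) :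
    ∃ k : ℕ → ℕ, StrictMono k ∧ (∀ j, P j (k j)) ∧
      ∀ g : X →ᵇ ℝ, Tendsto (fun j => ∫ x, g x ∂u j (k j)) atTop (𝓝 (∫ x, g x ∂w)) := by
  let U : ℕ → ℕ → FiniteMeasure X := fun j n => ⟨u j n, hu j n⟩
  let V : ℕ → FiniteMeasure X := fun j => ⟨v j, hv j⟩
  let W : FiniteMeasure X := ⟨w, hw⟩
  have hV0 : ∀ j, V j ≠ 0 := fun j h => hv0 j (congrArg Subtype.val h)
  have hW0 : W ≠ 0 := fun h => hw0 (congrArg Subtype.val h)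
  have hUV : ∀ j, Tendsto (U j) atTop (𝓝 (V j)) := fun j =>
    FiniteMeasure.tendsto_iff_forall_integral_tendsto.2 (huv j)
  have hVW : Tendsto V atTop (𝓝 W) := FiniteMeasure.tendsto_iff_forall_integral_tendsto.2 hvw
  let := TopologicalSpace.pseudoMetrizableSpacePseudoMetric (ProbabilityMeasure X)
  let F : FiniteMeasure X → ProbabilityMeasure X × ℝ≥0 := fun m => (m.normalize, m.mass)
  have hFU : ∀ j, Tendsto (fun n => F (U j n)) atTop (𝓝 (F (V j))) := fun j =>
    ((FiniteMeasure.tendsto_normalize_iff_tendsto (hV0 j)).2 (hUV j)).1.prodMk_nhds (hUV j).mass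
  have hFV : Tendsto (fun j => F (V j)) atTop (𝓝 (F W)) :=
    ((FiniteMeasure.tendsto_normalize_iff_tendsto hW0).2 hVW).1.prodMk_nhds hVW.mass
  obtain ⟨k, hk, hkP⟩ := extraction_forall_of_eventually
    (P := fun j n => P j n ∧ dist (F (U j n)) (F (V j)) < 1 / ((j : ℝ) + 1)) fun j =>
      (hP j).and ((Metric.tendsto_nhds.1 (hFU j)) _ Nat.one_div_pos_of_nat)
  refine ⟨k, hk, fun j => (hkP j).1, ?_⟩
  have hd : Tendsto (fun j => dist (F (V j)) (F (U j (k j)))) atTop (𝓝 0) := by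
    refine squeeze_zero (fun _ => dist_nonneg) (fun j => ?_)
      tendsto_one_div_add_atTop_nhds_zero_nat
    rw [dist_comm]
    exact (hkP j).2.le
  have hF := tendsto_of_tendsto_of_dist hFV hd
  have hlim : Tendsto (fun j => U j (k j)) atTop (𝓝 W) :=
    (FiniteMeasure.tendsto_normalize_iff_tendsto hW0).1
      ⟨(continuous_fst.tendsto _).comp hF, (continuous_snd.tendsto _).comp hF⟩
  exact FiniteMeasure.tendsto_iff_forall_integral_tendsto.1 hlim

end WeakConvergence

/-! ### The blow-up acting on phase space -/

section PhaseBlowUp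

open ProbabilityTheory
open scoped BoundedContinuousFunction

variable {d : ℕ} {E : Type*} [NormedAddCommGroup E] [InnerProductSpace ℝ E]

/-- The weight `(1 + a|z|) / (1 + |z|)` in terms of `w = hat z`. -/
def scaleWeight (a : ℝ) (w : E) : ℝ := 1 - min ‖w‖ 1 + a * min ‖w‖ 1

theorem continuous_scaleWeight (a : ℝ) : Continuous (scaleWeight a : E → ℝ) := by
  unfold scaleWeight; fun_prop

/-- Because of the truncation at 1, the weight is a convex combination of 1 and a. This keeps it
positive and bounded also outside the unit ball, so that `pullBack` is bounded on all of phase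
space. -/
theorem scaleWeight_pos {a : ℝ} (ha : 0 < a) (w : E) : 0 < scaleWeight a w := by
  unfold scaleWeight
  have h1 : min ‖w‖ 1 ≤ 1 := min_le_right _ _
  have h0 : 0 ≤ min ‖w‖ 1 := le_min (norm_nonneg _) zero_le_one
  rcases h0.eq_or_lt with h | h
  · rw [← h]; norm_num
  · have := mul_pos ha h
    linarith

theorem scaleWeight_le {a : ℝ} (ha : 0 < a) (w : E) : scaleWeight a w ≤ 1 + a := by
  unfold scaleWeight
  have h1 : min ‖w‖ 1 ≤ 1 := min_le_right _ _
  have h0 : 0 ≤ min ‖w‖ 1 := le_min (norm_nonneg _) zero_le_one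
  nlinarith

theorem scaleWeight_hat (a : ℝ) (z : E) :
    (1 + ‖z‖) * scaleWeight a (hat z) = 1 + a * ‖z‖ := by
  have : 0 < 1 + ‖z‖ := by positivity
  rw [scaleWeight, min_eq_left (norm_hat_lt_one z).le, norm_hat]
  field_simp; ring

theorem scaleWeight_of_norm_eq_one (a : ℝ) {w : E} (hw : ‖w‖ = 1) : scaleWeight a w = a := by
  simp [scaleWeight, hw]

/-- The action of the scaling `z ↦ a z` of `E` in terms of `w = hat z`. -/
def scaleHat (a : ℝ) (w : E) : E := (scaleWeight a w)⁻¹ • a • w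

theorem continuous_scaleHat {a : ℝ} (ha : 0 < a) : Continuous (scaleHat a : E → E) := by
  unfold scaleHat
  exact ((continuous_scaleWeight a).inv₀ fun w => (scaleWeight_pos ha w).ne').smul (by fun_prop)

theorem scaleHat_hat {a : ℝ} (ha : 0 < a) (z : E) : scaleHat a (hat z) = hat (a • z) := by
  have h : 0 < 1 + ‖z‖ := by positivity
  have h1 := scaleWeight_hat a z
  have h2 := scaleWeight_pos ha (hat z)
  have h3 : hat (a • z) = ((1 + ‖z‖) * scaleWeight a (hat z))⁻¹ • a • z := by
    rw [h1, hat, norm_smul, Real.norm_of_nonneg ha.le]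
  rw [scaleHat, h3]
  generalize scaleWeight a (hat z) = W at *
  rw [hat, smul_smul, smul_smul, smul_smul]
  congr 1
  field_simp

/-- Scaling of amplitudes extends to the sphere at infinity as the identity: directions are not
affected. -/
theorem scaleHat_of_norm_eq_one {a : ℝ} (ha : 0 < a) {w : E} (hw : ‖w‖ = 1) :
    scaleHat a w = w := by
  rw [scaleHat, scaleWeight_of_norm_eq_one a hw, smul_smul, inv_mul_cancel₀ ha.ne', one_smul]

/-- The blow-up at `x₀`, with microscopic shift `b` and amplitude factor `a`, acting on the phase
space. -/
def phaseBlow (x₀ : Space d) (r a : ℝ) (b : Torus d) (q : Phase d E) : Phase d E :=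
  (blowMap x₀ r q.1, q.2.1 - b, scaleHat a q.2.2)

theorem continuous_phaseBlow (x₀ : Space d) (r : ℝ) {a : ℝ} (ha : 0 < a) :
    Continuous fun p : Torus d × Phase d E => phaseBlow x₀ r a p.1 p.2 := by
  have h1 := blowMap_continuous x₀ r
  have h2 := continuous_scaleHat (E := E) ha
  unfold phaseBlow
  fun_prop

/-- The pull-back of a test function under the blow-up of phase space. -/
def pullBack (φ : Phase d E →ᵇ ℝ) (x₀ : Space d) {r a : ℝ} (hr : 0 < r) (ha : 0 < a)
    (b : Torus d) : Phase d E →ᵇ ℝ :=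
  BoundedContinuousFunction.ofNormedAddCommGroup
    (fun q => (r ^ d)⁻¹ * scaleWeight a q.2.2 * φ (phaseBlow x₀ r a b q))
    (by
      have h1 := continuous_scaleWeight (E := E) a
      have h2 : Continuous fun q : Phase d E => phaseBlow x₀ r a b q :=
        (continuous_phaseBlow x₀ r ha).comp (by fun_prop : Continuous fun q => (b, q))
      fun_prop)
    ((r ^ d)⁻¹ * (1 + a) * ‖φ‖) (fun q => by
      have hrd := pow_pos hr d
      rw [norm_mul, norm_mul, norm_inv, Real.norm_of_nonneg hrd.le,
        Real.norm_of_nonneg (scaleWeight_pos ha _).le]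
      gcongr
      · exact scaleWeight_le ha _
      · exact φ.norm_coe_le_norm _)

theorem pullBack_apply (φ : Phase d E →ᵇ ℝ) (x₀ : Space d) {r a : ℝ} (hr : 0 < r) (ha : 0 < a)
    (b : Torus d) (q : Phase d E) : pullBack φ x₀ hr ha b q =
      (r ^ d)⁻¹ * scaleWeight a q.2.2 * φ (phaseBlow x₀ r a b q) := rfl

theorem mul_pullBack_hat (φ : Phase d E →ᵇ ℝ) (x₀ : Space d) {r a : ℝ} (hr : 0 < r) (ha : 0 < a)
    (b : Torus d) (x : Space d) (ξ : Torus d) (z : E) :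
    (1 + ‖z‖) * pullBack φ x₀ hr ha b (x, ξ, hat z) =
      (r ^ d)⁻¹ * ((1 + ‖a • z‖) * φ (blowMap x₀ r x, ξ - b, hat (a • z))) := by
  have h1 := scaleWeight_hat a z
  rw [pullBack_apply, phaseBlow, scaleHat_hat ha, norm_smul, Real.norm_of_nonneg ha.le, ← h1]
  ring

/-- On the unit sphere the weight is exactly a. With a = c r^d the volume factor cancels, and
concentrations are multiplied by c alone. -/
theorem mul_pullBack_dir (φ : Phase d E →ᵇ ℝ) (x₀ : Space d) {r a : ℝ} (hr : 0 < r) (ha : 0 < a)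
    (b : Torus d) (x : Space d) (ξ : Torus d) (z : E) :
    ‖z‖ * pullBack φ x₀ hr ha b (x, ξ, dir z) =
      ((r ^ d)⁻¹ * a) * (‖z‖ * φ (blowMap x₀ r x, ξ - b, dir z)) := by
  by_cases hz : z = 0
  · simp [hz]
  · rw [pullBack_apply, phaseBlow, scaleHat_of_norm_eq_one ha (norm_dir hz),
      scaleWeight_of_norm_eq_one a (norm_dir hz)]
    ring

theorem pullBack_of_norm_eq_one (φ : Phase d E →ᵇ ℝ) (x₀ : Space d) {r a : ℝ} (hr : 0 < r)
    (ha : 0 < a) (b : Torus d) (x : Space d) (ξ : Torus d) {z : E} (hz : ‖z‖ = 1) :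
    pullBack φ x₀ hr ha b (x, ξ, z) = ((r ^ d)⁻¹ * a) * φ (blowMap x₀ r x, ξ - b, z) := by
  rw [pullBack_apply, phaseBlow, scaleHat_of_norm_eq_one ha hz, scaleWeight_of_norm_eq_one a hz]

/-- Joint continuity in the shift and the phase point, together with compactness of K × Z × closed
ball. -/
theorem pullBack_uniform [FiniteDimensional ℝ E] (φ : Phase d E →ᵇ ℝ) (x₀ : Space d) {r a : ℝ}
    (hr : 0 < r) (ha : 0 < a) (b₀ : Torus d) {K : Set (Space d)} (hK : IsCompact K) {δ : ℝ}
    (hδ : 0 < δ) : ∀ᶠ b in 𝓝 b₀, ∀ q : Phase d E, q.1 ∈ K → ‖q.2.2‖ ≤ 1 →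
      |pullBack φ x₀ hr ha b q - pullBack φ x₀ hr ha b₀ q| ≤ δ := by
  have hKc : IsCompact (K ×ˢ ((univ : Set (Torus d)) ×ˢ Metric.closedBall (0 : E) 1)) :=
    hK.prod (isCompact_univ.prod (isCompact_closedBall _ _))
  have hcont : Continuous (Function.uncurry fun (b : Torus d) (q : Phase d E) =>
      pullBack φ x₀ hr ha b q) := by
    have h1 := continuous_scaleWeight (E := E) a
    have h2 := continuous_phaseBlow (E := E) x₀ r ha
    simp only [pullBack_apply, Function.uncurry_def]
    fun_prop
  obtain ⟨v, hv, hvd⟩ := hKc.mem_uniformity_of_prod (s := univ) (q := b₀)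
    (u := {p : ℝ × ℝ | dist p.1 p.2 < δ}) hcont.continuousOn (mem_univ _)
    (Metric.dist_mem_uniformity hδ)
  rw [nhdsWithin_univ] at hv
  filter_upwards [hv] with b hb q hq1 hq2
  have := hvd b hb q ⟨hq1, mem_univ _, by simpa using hq2⟩
  exact (Real.dist_eq _ _ ▸ this : |_| < δ).le

end PhaseBlowUp

end

noncomputable section

/-! ### Change of variables for functionals and Young measures -/

section BlowUpIdentities

open ProbabilityTheory
open scoped BoundedContinuousFunction NNReal ENNReal

variable {d : ℕ} {E : Type*} [NormedAddCommGroup E] [InnerProductSpace ℝ E]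
  [MeasurableSpace E] [BorelSpace E] [FiniteDimensional ℝ E]

theorem isBounded_cube (x₀ : Space d) (r : ℝ) : Bornology.IsBounded (cube x₀ r) := by
  refine (Metric.isBounded_iff_subset_closedBall x₀).2 ⟨√(∑ _k : Fin d, (r / 2) ^ 2), fun x hx => ?_⟩
  rw [Metric.mem_closedBall, EuclideanSpace.dist_eq]
  refine Real.sqrt_le_sqrt (Finset.sum_le_sum fun k _ => ?_)
  rw [Real.dist_eq]
  exact pow_le_pow_left₀ (abs_nonneg _) (hx k) 2

theorem isBounded_unitCube : Bornology.IsBounded (unitCube d) := isBounded_cube _ _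

theorem isCompact_unitCube : IsCompact (unitCube d) :=
  Metric.isCompact_of_isClosed_isBounded isClosed_unitCube isBounded_unitCube

theorem volume_restrict_unitCube (x₀ : Space d) {r : ℝ} (hr : 0 < r) :
    (volume : Measure (Space d)).restrict (unitCube d) =
      ENNReal.ofReal (r ^ d)⁻¹ • (volume.restrict (cube x₀ r)).map (blowMap x₀ r) := by
  rw [← restrict_map_blowMap _ x₀ hr, map_blowMap_volume x₀ hr, Measure.restrict_smul, smul_smul,
    ← ENNReal.ofReal_mul (by positivity), inv_mul_cancel₀ (pow_pos hr d).ne', ENNReal.ofReal_one,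
    one_smul]

/-- The source of the shift ξ₀: in blown-up coordinates the microscopic variable is x/ε - x₀/ε,
whose offset depends on ε but not on r. -/
theorem toTorus_blowMap (ε : ℝ) (x₀ : Space d) {r : ℝ} (hr : 0 < r) (x : Space d) :
    toTorus ((ε / r)⁻¹ • blowMap x₀ r x) = toTorus (ε⁻¹ • x) - toTorus (ε⁻¹ • x₀) := by
  rw [← toTorus_sub, ← smul_sub, blowMap, smul_smul, inv_div]
  congr 2
  field_simp

/-- The substitution x = x₀ + ry turns the blow-up of μ into a change of the test function, leaving
the lift of μ itself untouched. Weak convergence of the original lifts can then be used. -/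
theorem integral_functionalLift_blowUp {Ω : Set (Space d)} (hΩ : Bornology.IsBounded Ω)
    {x₀ : Space d} {r c : ℝ} (hr : 0 < r) (hc : 0 < c) (ha : 0 < c * r ^ d)
    (hsub : cube x₀ r ⊆ Ω) (ε : ℝ) (μ : VectorMeasure (Space d) E) (φ : Phase d E →ᵇ ℝ) :
    ∫ q, φ q ∂functionalLift (unitCube d) (ε / r) (blowUp c x₀ r μ) =
      ∫ q in Prod.fst ⁻¹' cube x₀ r, pullBack φ x₀ hr ha (toTorus (ε⁻¹ • x₀)) q
        ∂functionalLift Ω ε μ := by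
  have hQ : MeasurableSet (unitCube d) := isClosed_unitCube.measurableSet
  have hcube : MeasurableSet (cube x₀ r) := (isClosed_cube x₀ r).measurableSet
  have hpre : MeasurableSet (Prod.fst ⁻¹' cube x₀ r : Set (Phase d E)) := measurable_fst hcube
  have hemb := measurableEmbedding_blowMap (d := d) x₀ hr.ne'
  set G := pullBack φ x₀ hr ha (toTorus (ε⁻¹ • x₀)) with hG
  rw [← integral_indicator hpre,
    integral_functionalLift hΩ ε μ (G.continuous.measurable.indicator hpre) (C := ‖G‖)
      (fun q => (norm_indicator_le_norm_self _ _).trans (G.norm_coe_le_norm q)),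
    integral_functionalLift isBounded_unitCube _ _ φ.continuous.measurable φ.norm_coe_le_norm]
  have hind : ∀ (F : Space d → ℝ) (p : Space d → Torus d × E) (m : Measure (Space d)),
      ∫ x in Ω, F x * (Prod.fst ⁻¹' cube x₀ r : Set (Phase d E)).indicator G (x, p x) ∂m =
        ∫ x in cube x₀ r, F x * G (x, p x) ∂m := by
    intro F p m
    rw [show ∫ x in cube x₀ r, F x * G (x, p x) ∂m =
        ∫ x in Ω, (cube x₀ r).indicator (fun x => F x * G (x, p x)) x ∂m by
      rw [setIntegral_indicator hcube, inter_eq_right.2 hsub]]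
    refine integral_congr_ae (ae_of_all _ fun x => ?_)
    by_cases hx : x ∈ cube x₀ r <;> simp [indicator, hx]
  rw [hind _ (fun x => (toTorus (ε⁻¹ • x), hat (acDensity μ x))),
    hind _ (fun x => (toTorus (ε⁻¹ • x), dir (singDensity μ x)))]
  congr 1
  · have h1 : ∫ y in unitCube d, (1 + ‖acDensity (blowUp c x₀ r μ) y‖) *
        φ (y, toTorus ((ε / r)⁻¹ • y), hat (acDensity (blowUp c x₀ r μ) y)) =
        ∫ y in unitCube d, (1 + ‖(c * r ^ d) • acDensity μ (x₀ + r • y)‖) *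
        φ (y, toTorus ((ε / r)⁻¹ • y), hat ((c * r ^ d) • acDensity μ (x₀ + r • y))) := by
      refine integral_congr_ae ?_
      filter_upwards [ae_restrict_of_ae (acDensity_blowUp c x₀ hr μ).1, ae_restrict_mem hQ]
        with y hy hyQ
      rw [hy, indicator_of_mem hyQ]
    rw [h1, volume_restrict_unitCube x₀ hr, integral_smul_measure, hemb.integral_map,
      ENNReal.toReal_ofReal (by positivity), smul_eq_mul, ← integral_const_mul]
    refine integral_congr_ae (ae_of_all _ fun x => ?_)
    simp only [hG, mul_pullBack_hat, blowMap_inverse x₀ hr.ne', toTorus_blowMap ε x₀ hr]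
  · have h1 : ∫ y in unitCube d, ‖singDensity (blowUp c x₀ r μ) y‖ *
        φ (y, toTorus ((ε / r)⁻¹ • y), dir (singDensity (blowUp c x₀ r μ) y))
          ∂singVariation (blowUp c x₀ r μ) =
        ∫ y in unitCube d, ‖singDensity μ (x₀ + r • y)‖ *
        φ (y, toTorus ((ε / r)⁻¹ • y), dir (singDensity μ (x₀ + r • y)))
          ∂singVariation (blowUp c x₀ r μ) := by
      refine integral_congr_ae ?_
      filter_upwards [ae_restrict_of_ae (singDensity_blowUp hc x₀ hr μ)] with y hy
      rw [hy]
    rw [h1, singVariation_blowUp hc.le x₀ hr, Measure.restrict_smul, integral_smul_measure,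
      hemb.restrict_map, preimage_blowMap_unitCube x₀ hr, Measure.restrict_restrict hcube,
      inter_self, hemb.integral_map, ENNReal.toReal_ofReal hc.le, smul_eq_mul,
      ← integral_const_mul]
    refine integral_congr_ae (ae_of_all _ fun x => ?_)
    simp only [hG, mul_pullBack_dir, blowMap_inverse x₀ hr.ne', toTorus_blowMap ε x₀ hr]
    have : (r ^ d)⁻¹ * (c * r ^ d) = c := by
      have := (pow_pos hr d).ne'
      field_simp
    rw [this]

/-- When the base is pushed forward by S, the fibre over S a must be the image of the old fibre over
a. A left inverse of S suffices to define it everywhere. -/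
theorem compProd_map_comap {A A' B B' : Type*} [MeasurableSpace A] [MeasurableSpace A']
    [MeasurableSpace B] [MeasurableSpace B'] {m : Measure A} [SFinite m] {κ : Kernel A B}
    [IsSFiniteKernel κ] {k : ℝ≥0∞} {s : Set A} (hs : MeasurableSet s) {S : A → A'} {S' : A' → A}
    (hS : Measurable S) (hS' : Measurable S') (hinv : ∀ a, S' (S a) = a) {G : B → B'}
    (hG : Measurable G) :
    (k • (m.restrict s).map S) ⊗ₘ ((κ.comap S' hS').map G) =
      k • ((m ⊗ₘ κ).restrict (Prod.fst ⁻¹' s)).map (Prod.map S G) := by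
  refine Measure.ext_of_lintegral _ fun f hf => ?_
  have hm : Measurable fun a => ∫⁻ b, f (a, b) ∂((κ.comap S' hS').map G) a :=
    hf.lintegral_kernel_prod_right'
  rw [Measure.lintegral_compProd hf, lintegral_smul_measure, lintegral_smul_measure,
    lintegral_map hm hS, lintegral_map hf (hS.prodMap hG), ← lintegral_indicator (measurable_fst hs),
    Measure.lintegral_compProd (f := (Prod.fst ⁻¹' s).indicator fun a => f (Prod.map S G a)) ((hf.comp (hS.prodMap hG)).indicator (measurable_fst hs)),
    ← lintegral_indicator hs]
  congr 2
  ext a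
  by_cases ha : a ∈ s
  · rw [indicator_of_mem ha, Kernel.map_apply _ hG, lintegral_map (by fun_prop) hG,
      Kernel.comap_apply, hinv]
    simp [indicator, ha]
  · simp [indicator, ha]

/-- The inverse `y ↦ x₀ + r y` of the blow-up map together with the inverse microscopic shift. -/
def unblow (x₀ : Space d) (r : ℝ) (b : Torus d) (p : Space d × Torus d) : Space d × Torus d :=
  (x₀ + r • p.1, p.2 + b)

/-- The blow-up of position and microscopic position. -/
def blowPair (x₀ : Space d) (r : ℝ) (b : Torus d) (p : Space d × Torus d) : Space d × Torus d :=
  (blowMap x₀ r p.1, p.2 - b)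

theorem measurable_unblow (x₀ : Space d) (r : ℝ) (b : Torus d) : Measurable (unblow x₀ r b) := by
  unfold unblow; fun_prop

theorem measurable_blowPair (x₀ : Space d) (r : ℝ) (b : Torus d) :
    Measurable (blowPair x₀ r b) := by
  have := (blowMap_continuous x₀ r).measurable
  unfold blowPair; fun_prop

theorem unblow_blowPair (x₀ : Space d) {r : ℝ} (hr : r ≠ 0) (b : Torus d)
    (p : Space d × Torus d) : unblow x₀ r b (blowPair x₀ r b p) = p := by
  simp [unblow, blowPair, blowMap_inverse x₀ hr]

/-- Haar measure on the torus is translation invariant, so the shift b is invisible here. -/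
theorem prod_restrict_unitCube (x₀ : Space d) {r : ℝ} (hr : 0 < r) (b : Torus d)
    {A : Set (Space d)} (hsub : cube x₀ r ⊆ A) :
    ((volume : Measure (Space d)).restrict (closure (unitCube d))).prod
        (volume : Measure (Torus d)) =
      ENNReal.ofReal (r ^ d)⁻¹ • (((volume.restrict A).prod volume).restrict
        (Prod.fst ⁻¹' cube x₀ r)).map (blowPair x₀ r b) := by
  have h1 : (volume : Measure (Torus d)).map (fun ξ => ξ - b) = volume := by
    simpa [sub_eq_add_neg] using map_add_right_eq_self (volume : Measure (Torus d)) (-b)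
  have h2 : (Prod.fst ⁻¹' cube x₀ r : Set (Space d × Torus d)) = cube x₀ r ×ˢ univ := by
    ext; simp
  rw [isClosed_unitCube.closure_eq, volume_restrict_unitCube x₀ hr, Measure.prod_smul_left]
  congr 1
  rw [h2, ← Measure.prod_restrict, Measure.restrict_univ,
    Measure.restrict_restrict (isClosed_cube x₀ r).measurableSet, inter_eq_left.2 hsub]
  conv_lhs => rw [← h1]
  exact Measure.map_prod_map _ _ (blowMap_continuous x₀ r).measurable (by fun_prop)

namespace YoungKernels

variable {D : Set (Space d)} (N : YoungKernels D E)

/-- The blow-up of a Young measure on the cube `Q_r(x₀)`, with microscopic shift `b`. -/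
def blow {x₀ : Space d} {r c : ℝ} (hr : 0 < r) (hsub : cube x₀ r ⊆ closure D) (b : Torus d) :
    YoungKernels (unitCube d) E where
  osc := (N.osc.comap (unblow x₀ r b) (measurable_unblow x₀ r b)).map fun z => (c * r ^ d) • z
  lam := ENNReal.ofReal c • (N.lam.restrict (cube x₀ r)).map (blowMap x₀ r)
  rho := (N.rho.comap (fun y => x₀ + r • y) (by fun_prop)).map fun ξ => ξ - b
  conc := N.conc.comap (unblow x₀ r b) (measurable_unblow x₀ r b)
  osc_markov := Kernel.IsMarkovKernel.map _ (by fun_prop)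
  lam_finite := Measure.smul_finite _ ENNReal.ofReal_ne_top
  rho_markov := Kernel.IsMarkovKernel.map _ (by fun_prop)
  conc_markov := inferInstance
  lam_support := by
    have hemb := measurableEmbedding_blowMap (d := d) x₀ hr.ne'
    rw [isClosed_unitCube.closure_eq, Measure.smul_apply, hemb.map_apply, preimage_compl,
      preimage_blowMap_unitCube x₀ hr,
      Measure.restrict_apply (isClosed_cube x₀ r).measurableSet.compl, compl_inter_self,
      measure_empty, smul_zero]
  osc_moment := by
    have hm : Measurable fun p : Space d × Torus d =>
        ∫⁻ z, ‖z‖ₑ ∂((N.osc.comap (unblow x₀ r b) (measurable_unblow x₀ r b)).map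
          fun z => (c * r ^ d) • z) p :=
      (by fun_prop : Measurable fun z : E => ‖z‖ₑ).lintegral_kernel
    rw [prod_restrict_unitCube x₀ hr b hsub, lintegral_smul_measure,
      lintegral_map hm (measurable_blowPair x₀ r b)]
    refine ENNReal.mul_lt_top ENNReal.ofReal_lt_top ?_
    have : ∀ p, ∫⁻ z, ‖z‖ₑ ∂((N.osc.comap (unblow x₀ r b) (measurable_unblow x₀ r b)).map
          fun z => (c * r ^ d) • z) (blowPair x₀ r b p) =
        ‖c * r ^ d‖ₑ * ∫⁻ z, ‖z‖ₑ ∂N.osc p := by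
      intro p
      rw [Kernel.map_apply _ (by fun_prop), lintegral_map (by fun_prop) (by fun_prop),
        Kernel.comap_apply, unblow_blowPair x₀ hr.ne']
      simp only [enorm_smul]
      exact lintegral_const_mul _ (by fun_prop)
    simp only [this]
    rw [lintegral_const_mul _ ((by fun_prop : Measurable fun z : E => ‖z‖ₑ).lintegral_kernel)]
    refine ENNReal.mul_lt_top (by finiteness) ?_
    exact (lintegral_mono' Measure.restrict_le_self le_rfl).trans_lt N.osc_moment

variable {x₀ : Space d} {r c : ℝ} (hr : 0 < r) (hsub : cube x₀ r ⊆ closure D) (b : Torus d)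

theorem oscMeasure_blow : (N.blow (c := c) hr hsub b).oscMeasure =
    ENNReal.ofReal (r ^ d)⁻¹ • (N.oscMeasure.restrict (Prod.fst ⁻¹' (Prod.fst ⁻¹' cube x₀ r))).map
      (Prod.map (blowPair x₀ r b) fun z => (c * r ^ d) • z) := by
  rw [oscMeasure, prod_restrict_unitCube x₀ hr b hsub]
  exact compProd_map_comap (measurable_fst (isClosed_cube x₀ r).measurableSet)
    (measurable_blowPair x₀ r b) (measurable_unblow x₀ r b) (unblow_blowPair x₀ hr.ne' b)
    (by fun_prop)

theorem concMeasure_blow : (N.blow (c := c) hr hsub b).concMeasure =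
    ENNReal.ofReal c • (N.concMeasure.restrict (Prod.fst ⁻¹' (Prod.fst ⁻¹' cube x₀ r))).map
      (Prod.map (blowPair x₀ r b) id) := by
  have h1 : (N.blow (c := c) hr hsub b).lam ⊗ₘ (N.blow (c := c) hr hsub b).rho =
      ENNReal.ofReal c • ((N.lam ⊗ₘ N.rho).restrict (Prod.fst ⁻¹' cube x₀ r)).map
        (blowPair x₀ r b) :=
    compProd_map_comap (isClosed_cube x₀ r).measurableSet (blowMap_continuous x₀ r).measurable
      (by fun_prop) (blowMap_inverse x₀ hr.ne') (by fun_prop)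
  rw [concMeasure, h1]
  have h2 : (N.blow (c := c) hr hsub b).conc =
      (N.conc.comap (unblow x₀ r b) (measurable_unblow x₀ r b)).map id := by
    rw [Kernel.map_id]; rfl
  rw [h2]
  exact compProd_map_comap (measurable_fst (isClosed_cube x₀ r).measurableSet)
    (measurable_blowPair x₀ r b) (measurable_unblow x₀ r b) (unblow_blowPair x₀ hr.ne' b)
    measurable_id

theorem integral_setOf_lift (hD : Bornology.IsBounded D) {s : Set (Space d)}
    (hs : MeasurableSet s) (G : Phase d E →ᵇ ℝ) :
    ∫ q in Prod.fst ⁻¹' s, G q ∂N.lift =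
      (∫ q in Prod.fst ⁻¹' (Prod.fst ⁻¹' s), (1 + ‖q.2‖) * G (q.1.1, q.1.2, hat q.2)
        ∂N.oscMeasure) +
      ∫ q in Prod.fst ⁻¹' (Prod.fst ⁻¹' s), G (q.1.1, q.1.2, (q.2 : E)) ∂N.concMeasure := by
  have hpre : MeasurableSet (Prod.fst ⁻¹' s : Set (Phase d E)) := measurable_fst hs
  rw [← integral_indicator hpre,
    N.integral_lift hD (G.continuous.measurable.indicator hpre) (C := ‖G‖)
      (fun q => (norm_indicator_le_norm_self _ _).trans (G.norm_coe_le_norm q)),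
    ← integral_indicator (measurable_fst (measurable_fst hs)),
    ← integral_indicator (measurable_fst (measurable_fst hs))]
  congr 1
  · refine integral_congr_ae (ae_of_all _ fun q => ?_)
    by_cases hq : q.1.1 ∈ s <;> simp [indicator, hq]

/-- The same pull-back appears as for the functionals, with the limit shift b in place of the class
of x₀/ε; this is why blowing up commutes with generation. -/
theorem integral_lift_blow (hD : Bornology.IsBounded D) (hc : 0 < c) (ha : 0 < c * r ^ d)
    (φ : Phase d E →ᵇ ℝ) :
    ∫ q, φ q ∂(N.blow (c := c) hr hsub b).lift =
      ∫ q in Prod.fst ⁻¹' cube x₀ r, pullBack φ x₀ hr ha b q ∂N.lift := by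
  have hhat := continuous_hat (E := E)
  have hbp := measurable_blowPair x₀ r b
  have hφ := φ.continuous.measurable
  rw [N.integral_setOf_lift hD (isClosed_cube x₀ r).measurableSet,
    integral_lift _ isBounded_unitCube hφ φ.norm_coe_le_norm, oscMeasure_blow, concMeasure_blow,
    integral_smul_measure, integral_smul_measure,
    integral_map (by fun_prop) (Measurable.aestronglyMeasurable (by fun_prop)),
    integral_map (by fun_prop) (Measurable.aestronglyMeasurable (by fun_prop)),
    ENNReal.toReal_ofReal hc.le, ENNReal.toReal_ofReal (by positivity), smul_eq_mul, smul_eq_mul,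
    ← integral_const_mul, ← integral_const_mul]
  congr 1
  · refine integral_congr_ae (ae_of_all _ fun q => ?_)
    simp only [mul_pullBack_hat]
    rfl
  · refine integral_congr_ae (ae_of_all _ fun q => ?_)
    simp only
    rw [pullBack_of_norm_eq_one _ _ _ _ _ _ _ (norm_coe_sphere q.2)]
    have : (r ^ d)⁻¹ * (c * r ^ d) = c := by
      have := (pow_pos hr d).ne'
      field_simp
    rw [this]
    rfl

/-- The frontier of the cylinder is the cylinder over the frontier, and the spatial marginals of the
two parts are absolutely continuous with respect to Lebesgue measure and λ. -/
theorem lift_frontier_null {s : Set (Space d)} (h0 : volume (frontier s) = 0)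
    (hlam : N.lam (frontier s) = 0) :
    N.lift (frontier (Prod.fst ⁻¹' s)) = 0 := by
  have hF : MeasurableSet (frontier s)ᶜ := isClosed_frontier.measurableSet.compl
  have key : ∀ᵐ q ∂N.lift, q.1 ∈ (frontier s)ᶜ ∧ ‖q.2.2‖ ≤ 1 := by
    rw [lift, ae_add_measure_iff]
    constructor
    · refine oscLift_null measurable_fst measurable_snd hF ?_
      rw [oscMeasure, Measure.ae_compProd_iff (hF.preimage (by fun_prop))]
      have h1 : ∀ᵐ p : Space d × Torus d ∂((volume.restrict (closure D)).prod volume),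
          p.1 ∈ (frontier s)ᶜ := by
        refine Measure.quasiMeasurePreserving_fst.ae (ae_restrict_of_ae ?_)
        exact measure_eq_zero_iff_ae_notMem.1 h0
      filter_upwards [h1] with p hp using ae_of_all _ fun _ => hp
    · refine concLift_null measurable_fst (by fun_prop) hF ?_
      rw [concMeasure, Measure.ae_compProd_iff (hF.preimage (by fun_prop)),
        Measure.ae_compProd_iff
          (p := fun a : Space d × Torus d => ∀ᵐ b ∂N.conc a, a.1 ∈ (frontier s)ᶜ)]
      · filter_upwards [measure_eq_zero_iff_ae_notMem.1 hlam] with x hx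
        exact ae_of_all _ fun _ => ae_of_all _ fun _ => hx
      · simp only [Filter.eventually_const]
        exact hF.preimage measurable_fst
  have hfr : frontier (Prod.fst ⁻¹' s : Set (Phase d E)) = Prod.fst ⁻¹' frontier s :=
    (isOpenMap_fst.preimage_frontier_eq_frontier_preimage continuous_fst s).symm
  rw [hfr]
  refine measure_mono_null (fun q hq => ?_) key
  exact fun h => h.1 hq

/-- At fixed radius both the test function and the measure vary with i. The former converges
uniformly on the relevant compact set as the shifts converge, and the null frontier handles the
latter. -/
theorem generates_blow {ε : ℕ → ℝ} {μ : ℕ → VectorMeasure (Space d) E}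
    (hD : Bornology.IsBounded D) (hDm : MeasurableSet D) (hsubD : cube x₀ r ⊆ D)
    (hgen : ∀ g : Phase d E →ᵇ ℝ,
      Tendsto (fun i => ∫ q, g q ∂(functionalLift D (ε i) (μ i))) atTop (𝓝 (∫ q, g q ∂N.lift)))
    (hb : Tendsto (fun i => toTorus ((ε i)⁻¹ • x₀)) atTop (𝓝 b)) (hc : 0 < c)
    (h0 : volume (frontier (cube x₀ r)) = 0) (hlam : N.lam (frontier (cube x₀ r)) = 0)
    (φ : Phase d E →ᵇ ℝ) :
    Tendsto (fun i => ∫ q, φ q ∂functionalLift (unitCube d) (ε i / r) (blowUp c x₀ r (μ i)))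
      atTop (𝓝 (∫ q, φ q ∂(N.blow (c := c) hr hsub b).lift)) := by
  have ha : 0 < c * r ^ d := by positivity
  have hfin : ∀ i, IsFiniteMeasure (functionalLift D (ε i) (μ i)) :=
    fun i => isFiniteMeasure_functionalLift hD _ _
  have hfinN := N.isFiniteMeasure_lift hD
  rw [N.integral_lift_blow hr hsub b hD hc ha φ]
  simp only [integral_functionalLift_blowUp hD hr hc ha hsubD]
  refine tendsto_setIntegral_of_uniform hgen (measurable_fst (isClosed_cube x₀ r).measurableSet)
    (N.lift_frontier_null h0 hlam) fun δ hδ => ?_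
  filter_upwards [hb.eventually (pullBack_uniform φ x₀ hr ha b
    (Metric.isCompact_of_isClosed_isBounded (isClosed_cube x₀ r) (isBounded_cube x₀ r)) hδ)]
    with i hi
  filter_upwards [functionalLift_null hDm (ε i) (μ i)] with q hq hqs
  exact hi q hqs hq.2

end YoungKernels

end BlowUpIdentities

end

noncomputable section

/-! ### Differentiation on cubes, admissible radii, tangent measures -/

section Differentiation

open scoped NNReal ENNReal

variable {d : ℕ}

/-- The identity from the Euclidean space to `Fin d → ℝ` with the supremum norm. -/
def toSup (d : ℕ) : Space d ≃ᵐ (Fin d → ℝ) := (MeasurableEquiv.toLp 2 (Fin d → ℝ)).symm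

theorem preimage_toSup_closedBall (x : Space d) {r : ℝ} (hr : 0 ≤ r) :
    toSup d ⁻¹' Metric.closedBall (toSup d x) (r / 2) = cube x r := by
  ext y
  simp only [mem_preimage, Metric.mem_closedBall, cube, mem_ofPred_eq]
  rw [dist_pi_le_iff (by positivity)]
  rfl

theorem map_toSup_closedBall (m : Measure (Space d)) (x : Space d) {r : ℝ} (hr : 0 ≤ r) :
    m.map (toSup d) (Metric.closedBall (toSup d x) (r / 2)) = m (cube x r) := by
  rw [(toSup d).map_apply, preimage_toSup_closedBall x hr]

theorem tendsto_half_nhdsGT : Tendsto (fun r : ℝ => r / 2) (𝓝[>] 0) (𝓝[>] 0) := by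
  refine tendsto_nhdsWithin_iff.2 ⟨?_, ?_⟩
  · have : Tendsto (fun r : ℝ => r / 2) (𝓝 0) (𝓝 (0 / 2)) :=
      (continuous_id.div_const 2).tendsto _
    rw [zero_div] at this
    exact this.mono_left nhdsWithin_le_nhds
  · filter_upwards [self_mem_nhdsWithin] with r hr
    exact half_pos (show (0 : ℝ) < r from hr)

/-- Cubes are balls of the supremum norm, so after transport by `toSup` Besicovitch differentiation
applies; the Radon–Nikodym derivative vanishes by singularity. -/
theorem ae_tendsto_cube_div_of_mutuallySingular {ρ m : Measure (Space d)} [IsFiniteMeasure ρ]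
    [IsFiniteMeasure m] (h : ρ ⟂ₘ m) :
    ∀ᵐ x ∂m, Tendsto (fun r => ρ (cube x r) / m (cube x r)) (𝓝[>] 0) (𝓝 0) := by
  have hsing : ρ.map (toSup d) ⟂ₘ m.map (toSup d) := by
    obtain ⟨s, hs, h1, h2⟩ := h
    refine ⟨(toSup d).symm ⁻¹' s, (toSup d).symm.measurable hs, ?_, ?_⟩
    · rw [(toSup d).map_apply, ← preimage_comp]; simpa using h1
    · rw [(toSup d).map_apply, preimage_compl, ← preimage_comp]; simpa using h2
  have h1 := Besicovitch.ae_tendsto_rnDeriv (ρ.map (toSup d)) (m.map (toSup d))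
  have h2 := hsing.rnDeriv_ae_eq_zero
  have h3 := ae_of_ae_map (toSup d).measurable.aemeasurable (h1.and h2)
  filter_upwards [h3] with x hx
  have hx1 := hx.1
  rw [hx.2] at hx1
  refine (hx1.comp tendsto_half_nhdsGT).congr' ?_
  filter_upwards [self_mem_nhdsWithin] with r hr
  have hr : (0 : ℝ) < r := hr
  simp only [Function.comp_apply, map_toSup_closedBall _ _ hr.le]

theorem ae_tendsto_cube_lintegral_sub_div {m : Measure (Space d)} [IsFiniteMeasure m]
    {f : Space d → ℝ} (hf : Integrable f m) :
    ∀ᵐ x ∂m, Tendsto (fun r => (∫⁻ y in cube x r, ‖f y - f x‖ₑ ∂m) / m (cube x r))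
      (𝓝[>] 0) (𝓝 0) := by
  have hf' : Integrable (f ∘ (toSup d).symm) (m.map (toSup d)) := by
    rw [(toSup d).measurableEmbedding.integrable_map_iff]
    simpa [Function.comp_def] using hf
  have h1 := (Besicovitch.vitaliFamily (m.map (toSup d))).ae_tendsto_lintegral_enorm_sub_div
    hf'.locallyIntegrable
  have h3 := ae_of_ae_map (toSup d).measurable.aemeasurable h1
  filter_upwards [h3] with x hx
  refine ((hx.comp (Besicovitch.tendsto_filterAt _ _)).comp tendsto_half_nhdsGT).congr' ?_
  filter_upwards [self_mem_nhdsWithin] with r hr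
  have hr : (0 : ℝ) < r := hr
  simp only [Function.comp_apply, map_toSup_closedBall _ _ hr.le]
  rw [(toSup d).measurableEmbedding.restrict_map, preimage_toSup_closedBall x hr.le,
    (toSup d).measurableEmbedding.lintegral_map]
  simp

theorem cube_mem_nhds (x : Space d) {r : ℝ} (hr : 0 < r) : cube x r ∈ 𝓝 x := by
  have : {y : Space d | ∀ k, |y k - x k| < r / 2} ∈ 𝓝 x := by
    have h : IsOpen {y : Space d | ∀ k, |y k - x k| < r / 2} := by
      have : {y : Space d | ∀ k, |y k - x k| < r / 2} = ⋂ k, {y : Space d | |y k - x k| < r / 2} := by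
        ext; simp
      rw [this]
      exact isOpen_iInter_of_finite fun k => isOpen_lt (by fun_prop) continuous_const
    exact h.mem_nhds fun k => by simpa using hr
  exact mem_of_superset this fun y hy k => (hy k).le

theorem ae_cube_pos (m : Measure (Space d)) :
    ∀ᵐ x ∂m, ∀ r, 0 < r → 0 < m (cube x r) := by
  filter_upwards [Measure.support_mem_ae (μ := m)] with x hx r hr
  exact Measure.mem_support_iff_forall x |>.1 hx _ (cube_mem_nhds x hr)

theorem frontier_cube_subset (x : Space d) (r : ℝ) :
    frontier (cube x r) ⊆ cube x r ∩ ⋃ k, {y | |y k - x k| = r / 2} := by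
  intro y hy
  have hyc : y ∈ cube x r := (isClosed_cube x r).frontier_subset hy
  refine ⟨hyc, ?_⟩
  by_contra hcon
  simp only [mem_iUnion, mem_ofPred_eq, not_exists] at hcon
  have h : IsOpen {y : Space d | ∀ k, |y k - x k| < r / 2} := by
    have : {y : Space d | ∀ k, |y k - x k| < r / 2} = ⋂ k, {y : Space d | |y k - x k| < r / 2} := by
      ext; simp
    rw [this]
    exact isOpen_iInter_of_finite fun k => isOpen_lt (by fun_prop) continuous_const
  have hint : y ∈ interior (cube x r) :=
    interior_maximal (t := {y : Space d | ∀ k, |y k - x k| < r / 2})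
      (fun z hz k => (hz k).le) h fun k => lt_of_le_of_ne (hyc k) (hcon k)
  exact hy.2 hint

theorem exists_radius_frontier_null (κ : Measure (Space d)) [SFinite κ] (x : Space d) {δ : ℝ}
    (hδ : 0 < δ) : ∃ r, 0 < r ∧ r < δ ∧ κ (frontier (cube x r)) = 0 := by
  -- A point of `A r` determines r as twice its supremum distance from x. These sets are thus
  -- disjoint, and only countably many of them are charged by `κ`.
  let A : ℝ → Set (Space d) := fun r => cube x r ∩ ⋃ k, {y | |y k - x k| = r / 2}
  have hA : ∀ r, MeasurableSet (A r) := fun r =>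
    (isClosed_cube x r).measurableSet.inter (MeasurableSet.iUnion fun k =>
      (isClosed_eq (by fun_prop) continuous_const).measurableSet)
  have hle : ∀ r r' y, y ∈ A r → y ∈ A r' → r ≤ r' := by
    rintro r r' y ⟨_, h2⟩ ⟨h3, _⟩
    obtain ⟨k, hk⟩ := mem_iUnion.1 h2
    have hk : |y k - x k| = r / 2 := hk
    have := h3 k
    linarith
  have hdisj : Pairwise (Function.onFun Disjoint A) := fun r r' hne =>
    disjoint_left.2 fun y h1 h2 => hne (le_antisymm (hle r r' y h1 h2) (hle r' r y h2 h1))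
  have hcount := Measure.countable_meas_pos_of_disjoint_iUnion (μ := κ) hA hdisj
  obtain ⟨r, hr, h0, h1⟩ := (hcount.dense_compl ℝ).exists_between hδ
  refine ⟨r, h0, h1, measure_mono_null (frontier_cube_subset x r) ?_⟩
  simpa using hr

theorem blowUpProb_eq (κ : Measure (Space d)) (x : Space d) {r : ℝ} (hr : 0 < r) :
    blowUpProb κ x r = (κ (cube x r))⁻¹ • (κ.restrict (cube x r)).map (blowMap x r) := by
  rw [blowUpProb, restrict_map_blowMap _ _ hr]

/-- The normalized blow-ups are probability measures on the compact cube, and the space of such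
measures is sequentially compact. -/
theorem exists_subseq_tangentMeasure (κ : Measure (Space d)) [IsFiniteMeasure κ] (x : Space d)
    {r : ℕ → ℝ} (hr : ∀ j, 0 < r j) (hpos : ∀ j, 0 < κ (cube x (r j))) :
    ∃ (s : ℕ → ℕ) (τ : Measure (Space d)), StrictMono s ∧ IsProbabilityMeasure τ ∧
      τ (unitCube d)ᶜ = 0 ∧ ∀ φ : Space d → ℝ, Continuous φ →
        Tendsto (fun j => ∫ y, φ y ∂(blowUpProb κ x (r (s j)))) atTop (𝓝 (∫ y, φ y ∂τ)) := by
  have hQ : MeasurableSet (unitCube d) := isClosed_unitCube.measurableSet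
  have hcomp : CompactSpace (unitCube d) := isCompact_iff_compactSpace.1 isCompact_unitCube
  have hval : MeasurableEmbedding (Subtype.val : unitCube d → Space d) :=
    MeasurableEmbedding.subtype_coe hQ
  have hprob : ∀ j, IsProbabilityMeasure
      ((blowUpProb κ x (r j)).comap (Subtype.val : unitCube d → Space d)) := by
    intro j
    refine ⟨?_⟩
    rw [hval.comap_apply, image_univ, Subtype.range_coe, blowUpProb, Measure.smul_apply,
      Measure.restrict_apply_self,
      (measurableEmbedding_blowMap x (hr j).ne').map_apply, preimage_blowMap_unitCube x (hr j),
      smul_eq_mul, ENNReal.inv_mul_cancel (hpos j).ne' (measure_ne_top _ _)]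
  let p : ℕ → ProbabilityMeasure (unitCube d) := fun j => ⟨_, hprob j⟩
  obtain ⟨P, s, hs, hlim⟩ := CompactSpace.tendsto_subseq p
  refine ⟨s, (P : Measure (unitCube d)).map Subtype.val, hs,
    Measure.isProbabilityMeasure_map hval.measurable.aemeasurable, ?_, fun φ hφ => ?_⟩
  · rw [hval.map_apply]; simp
  · have h1 := (ProbabilityMeasure.tendsto_iff_forall_integral_tendsto.1 hlim)
      (BoundedContinuousFunction.mkOfCompact ⟨fun y : unitCube d => φ y, by fun_prop⟩)
    rw [hval.integral_map]
    refine h1.congr fun j => ?_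
    change ∫ y : unitCube d, φ y ∂((blowUpProb κ x (r (s j))).comap Subtype.val) = _
    rw [integral_subtype_comap hQ, blowUpProb, Measure.restrict_smul,
      Measure.restrict_restrict hQ, inter_self]

end Differentiation

end

noncomputable section

/-! ### The tangent Young measure and the collapse of oscillations -/

section TangentLimit

open ProbabilityTheory
open scoped BoundedContinuousFunction NNReal ENNReal

variable {d : ℕ} {E : Type*} [NormedAddCommGroup E] [InnerProductSpace ℝ E]
  [MeasurableSpace E] [BorelSpace E] [FiniteDimensional ℝ E]

theorem exists_growth_bound (g : Phase d E →ᵇ ℝ) {K : Set (Space d)} (hK : IsCompact K) {δ : ℝ}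
    (hδ : 0 < δ) : ∃ C, 0 ≤ C ∧ ∀ y ∈ K, ∀ (ξ : Torus d) (w : E),
      |(1 + ‖w‖) * g (y, ξ, hat w) - g (y, ξ, 0)| ≤ δ + C * ‖w‖ := by
  have hKc : IsCompact (K ×ˢ (univ : Set (Torus d))) := hK.prod isCompact_univ
  have hcont : Continuous (Function.uncurry fun (v : E) (q : Space d × Torus d) =>
      g (q.1, q.2, v)) := by
    simp only [Function.uncurry_def]
    fun_prop
  obtain ⟨V, hV, hVd⟩ := hKc.mem_uniformity_of_prod (s := univ) (q := (0 : E))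
    (u := {p : ℝ × ℝ | dist p.1 p.2 < δ}) hcont.continuousOn (mem_univ _)
    (Metric.dist_mem_uniformity hδ)
  rw [nhdsWithin_univ] at hV
  obtain ⟨η, hη, hηV⟩ := Metric.mem_nhds_iff.1 hV
  -- Near w = 0 only the term ‖w‖‖g‖ remains beyond δ. Otherwise ‖w‖ ≥ η, and 2/η absorbs the two
  -- bounded terms.
  refine ⟨‖g‖ * (2 / η + 1), by positivity, fun y hy ξ w => ?_⟩
  have hw0 := norm_nonneg w
  have hg0 := norm_nonneg g
  have g1 : |g (y, ξ, hat w)| ≤ ‖g‖ := g.norm_coe_le_norm _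
  have g2 : |g (y, ξ, 0)| ≤ ‖g‖ := g.norm_coe_le_norm _
  have hle : ‖hat w‖ ≤ ‖w‖ := by
    rw [norm_hat]
    exact div_le_self hw0 (by linarith)
  by_cases hw : ‖hat w‖ < η
  · have h1 : |g (y, ξ, hat w) - g (y, ξ, 0)| < δ := by
      have := hVd (hat w) (hηV (by simpa using hw)) (y, ξ) ⟨hy, mem_univ _⟩
      simpa [Real.dist_eq] using this
    calc |(1 + ‖w‖) * g (y, ξ, hat w) - g (y, ξ, 0)|
        = |(g (y, ξ, hat w) - g (y, ξ, 0)) + ‖w‖ * g (y, ξ, hat w)| := by ring_nf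
      _ ≤ |g (y, ξ, hat w) - g (y, ξ, 0)| + |‖w‖ * g (y, ξ, hat w)| := abs_add_le _ _
      _ ≤ δ + ‖w‖ * ‖g‖ := by
          rw [abs_mul, abs_of_nonneg hw0]
          gcongr
      _ ≤ δ + ‖g‖ * (2 / η + 1) * ‖w‖ := by
          have : 0 ≤ ‖g‖ * (2 / η) * ‖w‖ := by positivity
          nlinarith
  · have hηw : η ≤ ‖w‖ := (not_lt.1 hw).trans hle
    have h2 : 2 ≤ 2 / η * ‖w‖ := by
      rw [div_mul_eq_mul_div, le_div_iff₀ hη]; linarith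
    calc |(1 + ‖w‖) * g (y, ξ, hat w) - g (y, ξ, 0)|
        ≤ |(1 + ‖w‖) * g (y, ξ, hat w)| + |g (y, ξ, 0)| := abs_sub _ _
      _ ≤ (1 + ‖w‖) * ‖g‖ + ‖g‖ := by
          rw [abs_mul, abs_of_nonneg (by positivity : 0 ≤ 1 + ‖w‖)]
          gcongr
      _ ≤ ‖g‖ * (2 / η + 1) * ‖w‖ := by nlinarith [mul_le_mul_of_nonneg_left h2 hg0]
      _ ≤ _ := by linarith

/-- Continuous test functions of microscopic position and direction. -/
abbrev AngularTest (d : ℕ) (E : Type*) [NormedAddCommGroup E] :=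
  C(Torus d × Metric.sphere (0 : E) 1, ℝ)

/-- The slices `(ξ, z) ↦ g(y, ξ - b, z)` of a test function. -/
def angularSlice (g : Phase d E →ᵇ ℝ) (b : Torus d) : C(Space d, AngularTest d E) :=
  ContinuousMap.curry ⟨fun p : Space d × (Torus d × Metric.sphere (0 : E) 1) =>
    g (p.1, p.2.1 - b, (p.2.2 : E)), by fun_prop⟩

theorem norm_angularSlice_le (g : Phase d E →ᵇ ℝ) (b : Torus d) (y : Space d) :
    ‖angularSlice g b y‖ ≤ ‖g‖ :=
  (ContinuousMap.norm_le _ (norm_nonneg _)).2 fun _ => g.norm_coe_le_norm _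

namespace YoungKernels

variable {D : Set (Space d)} (N : YoungKernels D E)

/-- The average of an angular test function at the macroscopic point `x`. -/
def angularAverage (φ : AngularTest d E) (x : Space d) : ℝ :=
  ∫ p, φ p ∂((N.rho ⊗ₖ N.conc) x)

theorem integrable_angularTest (φ : AngularTest d E) (m : Measure (Torus d × Metric.sphere (0 : E) 1))
    [IsFiniteMeasure m] : Integrable φ m :=
  .of_bound φ.continuous.aestronglyMeasurable ‖φ‖ (ae_of_all _ φ.norm_coe_le_norm)

theorem abs_angularAverage_le (φ : AngularTest d E) (x : Space d) :
    |N.angularAverage φ x| ≤ ‖φ‖ := by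
  have := norm_integral_le_of_norm_le_const (μ := (N.rho ⊗ₖ N.conc) x)
    (ae_of_all _ φ.norm_coe_le_norm)
  simpa [angularAverage] using this

theorem angularAverage_sub (φ ψ : AngularTest d E) (x : Space d) :
    N.angularAverage (φ - ψ) x = N.angularAverage φ x - N.angularAverage ψ x := by
  rw [angularAverage, angularAverage, angularAverage,
    ← integral_sub (integrable_angularTest _ _) (integrable_angularTest _ _)]
  rfl

theorem abs_angularAverage_sub_le (φ ψ : AngularTest d E) (x : Space d) :
    |N.angularAverage φ x - N.angularAverage ψ x| ≤ ‖φ - ψ‖ := by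
  rw [← angularAverage_sub]
  exact N.abs_angularAverage_le _ x

theorem measurable_angularAverage (φ : AngularTest d E) : Measurable (N.angularAverage φ) :=
  (StronglyMeasurable.integral_kernel (κ := N.rho ⊗ₖ N.conc)
    φ.continuous.stronglyMeasurable).measurable

theorem continuous_angularAverage (x : Space d) :
    Continuous fun φ : AngularTest d E => N.angularAverage φ x :=
  (LipschitzWith.of_dist_le_mul (K := 1) fun φ ψ => by
    rw [Real.dist_eq, dist_eq_norm]
    simpa using N.abs_angularAverage_sub_le φ ψ x).continuous

theorem angularAverage_eq (φ : AngularTest d E) (x : Space d) :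
    N.angularAverage φ x = ∫ ξ, ∫ z, φ (ξ, z) ∂N.conc (x, ξ) ∂N.rho x :=
  integral_compProd (integrable_angularTest _ _)

theorem measurable_angularAverage_slice (g : Phase d E →ᵇ ℝ) (b : Torus d) {F : Space d → Space d}
    (hF : Measurable F) : Measurable fun x => N.angularAverage (angularSlice g b (F x)) x := by
  refine (StronglyMeasurable.integral_kernel_prod_right' (κ := N.rho ⊗ₖ N.conc)
    (f := fun p : Space d × (Torus d × Metric.sphere (0 : E) 1) =>
      g (F p.1, p.2.1 - b, (p.2.2 : E))) ?_).measurable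
  exact Measurable.stronglyMeasurable (by
    have := g.continuous.measurable
    fun_prop)

/-- Integration of an angular test function against the concentration part. -/
theorem setIntegral_concMeasure {s : Set (Space d)} (hs : MeasurableSet s)
    (F : (Space d × Torus d) × Metric.sphere (0 : E) 1 → ℝ) (hF : Measurable F) {C : ℝ}
    (hC : ∀ q, |F q| ≤ C) :
    ∫ q in Prod.fst ⁻¹' (Prod.fst ⁻¹' s), F q ∂N.concMeasure =
      ∫ x in s, ∫ ξ, ∫ z, F ((x, ξ), z) ∂N.conc (x, ξ) ∂N.rho x ∂N.lam := by
  have hpre : MeasurableSet (Prod.fst ⁻¹' (Prod.fst ⁻¹' s) :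
    Set ((Space d × Torus d) × Metric.sphere (0 : E) 1)) := measurable_fst (measurable_fst hs)
  have hint : Integrable ((Prod.fst ⁻¹' (Prod.fst ⁻¹' s) :
      Set ((Space d × Torus d) × Metric.sphere (0 : E) 1)).indicator F) N.concMeasure :=
    .of_bound (hF.indicator hpre).aestronglyMeasurable C
      (ae_of_all _ fun q => (norm_indicator_le_norm_self _ _).trans (hC q))
  rw [← integral_indicator hpre]
  rw [concMeasure] at hint ⊢
  rw [Measure.integral_compProd hint, Measure.integral_compProd (integrable_integral_compProd hint),
    ← integral_indicator hs]
  refine integral_congr_ae (ae_of_all _ fun x => ?_)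
  by_cases hx : x ∈ s <;> simp [indicator, hx]

theorem setIntegral_concMeasure_slice {s : Set (Space d)} (hs : MeasurableSet s)
    (g : Phase d E →ᵇ ℝ) (b : Torus d) {F : Space d → Space d} (hF : Measurable F) :
    ∫ q in Prod.fst ⁻¹' (Prod.fst ⁻¹' s), g (F q.1.1, q.1.2 - b, (q.2 : E)) ∂N.concMeasure =
      ∫ x in s, N.angularAverage (angularSlice g b (F x)) x ∂N.lam := by
  rw [N.setIntegral_concMeasure hs _ (by
    have := g.continuous.measurable
    fun_prop) (C := ‖g‖) fun q => g.norm_coe_le_norm _]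
  refine integral_congr_ae (ae_of_all _ fun x => ?_)
  simp only [angularAverage_eq]
  rfl

/-- The homogeneous tangent Young measure at `x₀`, with concentration measure `τ`. -/
def tangent (x₀ : Space d) (b : Torus d) (τ : Measure (Space d)) [IsFiniteMeasure τ]
    (hτ : τ (unitCube d)ᶜ = 0) : YoungKernels (unitCube d) E where
  osc := Kernel.const _ (Measure.dirac 0)
  lam := τ
  rho := Kernel.const _ ((N.rho x₀).map fun ξ => ξ - b)
  conc := N.conc.comap (fun p => (x₀, p.2 + b)) (by fun_prop)
  osc_markov := inferInstance
  lam_finite := inferInstance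
  rho_markov := by
    have : IsProbabilityMeasure ((N.rho x₀).map fun ξ => ξ - b) :=
      Measure.isProbabilityMeasure_map (by fun_prop)
    infer_instance
  conc_markov := inferInstance
  lam_support := by rwa [isClosed_unitCube.closure_eq]
  osc_moment := by simp

/-- The shift by -b in the microscopic measure and by +b in the concentration kernel cancel, leaving
the angular average at x₀ of a shifted slice of g. -/
theorem integral_tangent_lift (x₀ : Space d) (b : Torus d) (τ : Measure (Space d))
    [IsFiniteMeasure τ] (hτ : τ (unitCube d)ᶜ = 0) (g : Phase d E →ᵇ ℝ) :
    ∫ q, g q ∂(N.tangent x₀ b τ hτ).lift =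
      (∫ p : Space d × Torus d, g (p.1, p.2, 0)
        ∂((volume.restrict (closure (unitCube d))).prod volume)) +
      ∫ y, N.angularAverage (angularSlice g b y) x₀ ∂τ := by
  have hg := g.continuous.measurable
  have hhat := continuous_hat (E := E)
  have hfin : IsFiniteMeasure (volume.restrict (closure (unitCube d))) :=
    ⟨by simpa using (isBounded_unitCube (d := d)).closure.measure_lt_top⟩
  rw [integral_lift _ isBounded_unitCube hg g.norm_coe_le_norm]
  congr 1
  · have hosc : (N.tangent x₀ b τ hτ).oscMeasure =
        ((volume.restrict (closure (unitCube d))).prod (volume : Measure (Torus d))).map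
          fun p => (p, 0) := by
      rw [oscMeasure]
      simp only [tangent]
      rw [Measure.compProd_const, Measure.prod_dirac]
    rw [hosc, integral_map (by fun_prop) (Measurable.aestronglyMeasurable (by fun_prop))]
    simp [hat]
  · have := (N.tangent x₀ b τ hτ).setIntegral_concMeasure_slice (s := univ) MeasurableSet.univ g 0
      (F := id) measurable_id
    simp only [preimage_univ, Measure.restrict_univ, sub_zero, id] at this
    rw [this]
    refine integral_congr_ae (ae_of_all _ fun y => ?_)
    simp only [angularAverage_eq]
    simp only [tangent, Kernel.const_apply, Kernel.comap_apply]
    have hemb : MeasurableEmbedding fun ξ : Torus d => ξ - b :=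
      (MeasurableEquiv.subRight b).measurableEmbedding
    rw [hemb.integral_map]
    refine integral_congr_ae (ae_of_all _ fun ξ => ?_)
    simp [angularSlice]

/-- The macroscopic marginal of the first moment of the oscillation part. -/
def momentMeasure : Measure (Space d) :=
  (N.oscMeasure.withDensity fun q => ‖q.2‖ₑ).map fun q => q.1.1

instance : IsFiniteMeasure N.momentMeasure := by
  have : IsFiniteMeasure (N.oscMeasure.withDensity fun q => ‖q.2‖ₑ) :=
    isFiniteMeasure_withDensity N.integrable_snd_oscMeasure.2.ne
  unfold momentMeasure; infer_instance

/-- The spatial marginal of `oscMeasure` is absolutely continuous. Hence the first moment is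
singular to λ^s and negligible in the blow-up. -/
theorem momentMeasure_absolutelyContinuous : N.momentMeasure ≪ volume := by
  have h1 : N.oscMeasure.map (fun q => q.1.1) ≪ volume := by
    have h2 : N.oscMeasure.map Prod.fst = (volume.restrict (closure D)).prod volume :=
      Measure.fst_compProd _ _
    have h3 : N.oscMeasure.map (fun q => q.1.1) =
        ((volume.restrict (closure D)).prod (volume : Measure (Torus d))).map Prod.fst := by
      rw [← h2, Measure.map_map measurable_fst measurable_fst]
      rfl
    rw [h3, Measure.map_fst_prod]
    exact (Measure.absolutelyContinuous_of_le Measure.restrict_le_self).smul_left _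
  exact ((withDensity_absolutelyContinuous _ _).map (by fun_prop)).trans h1

theorem integral_norm_oscMeasure_blow {x₀ : Space d} {r c : ℝ} (hr : 0 < r) (hc : 0 < c)
    (hsub : cube x₀ r ⊆ closure D) (b : Torus d) :
    ∫ q, ‖q.2‖ ∂(N.blow (c := c) hr hsub b).oscMeasure =
      c * (N.momentMeasure (cube x₀ r)).toReal := by
  have hbp := measurable_blowPair x₀ r b
  have hcube : MeasurableSet (cube x₀ r) := (isClosed_cube x₀ r).measurableSet
  have h1 : ∫ q in Prod.fst ⁻¹' (Prod.fst ⁻¹' cube x₀ r), ‖q.2‖ ∂N.oscMeasure =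
      (N.momentMeasure (cube x₀ r)).toReal := by
    rw [integral_norm_eq_lintegral_enorm (by fun_prop), momentMeasure,
      Measure.map_apply (by fun_prop) hcube,
      withDensity_apply _ ((by fun_prop : Measurable fun q : (Space d × Torus d) × E => q.1.1)
        hcube)]
    rfl
  rw [oscMeasure_blow, integral_smul_measure,
    integral_map (by fun_prop) (Measurable.aestronglyMeasurable (by fun_prop)), ← h1,
    ENNReal.toReal_ofReal (by positivity), smul_eq_mul]
  simp only [Prod.map_snd, norm_smul]
  rw [integral_const_mul, ← mul_assoc, Real.norm_of_nonneg (by positivity)]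
  congr 1
  have := (pow_pos hr d).ne'
  field_simp

/-- All blown-up oscillation measures have the same base marginal on Q × Z, while their first
moments tend to 0. By `exists_growth_bound`, the integrand may be replaced by its value at z = 0. -/
theorem tendsto_osc_blow {x₀ : Space d} {r c : ℕ → ℝ} (hr : ∀ j, 0 < r j) (hc : ∀ j, 0 < c j)
    (hsub : ∀ j, cube x₀ (r j) ⊆ closure D) (b : Torus d)
    (hmom : Tendsto (fun j => c j * (N.momentMeasure (cube x₀ (r j))).toReal) atTop (𝓝 0))
    (g : Phase d E →ᵇ ℝ) :
    Tendsto (fun j => ∫ q, (1 + ‖q.2‖) * g (q.1.1, q.1.2, hat q.2)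
        ∂(N.blow (c := c j) (hr j) (hsub j) b).oscMeasure) atTop
      (𝓝 (∫ p : Space d × Torus d, g (p.1, p.2, 0)
        ∂((volume.restrict (closure (unitCube d))).prod volume))) := by
  have hg := g.continuous.measurable
  have hhat := continuous_hat (E := E)
  have hfin : IsFiniteMeasure (volume.restrict (closure (unitCube d))) :=
    ⟨by simpa using (isBounded_unitCube (d := d)).closure.measure_lt_top⟩
  set B := ((volume.restrict (closure (unitCube d))).prod
    (volume : Measure (Torus d))).real univ with hB
  have hcl : MeasurableSet (closure (unitCube d)) := isClosed_closure.measurableSet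
  have key : ∀ δ > 0, ∃ C, ∀ j, |(∫ q, (1 + ‖q.2‖) * g (q.1.1, q.1.2, hat q.2)
        ∂(N.blow (c := c j) (hr j) (hsub j) b).oscMeasure) -
      ∫ p : Space d × Torus d, g (p.1, p.2, 0)
        ∂((volume.restrict (closure (unitCube d))).prod volume)| ≤
      δ * B + C * (c j * (N.momentMeasure (cube x₀ (r j))).toReal) := by
    intro δ hδ
    obtain ⟨C, hC0, hC⟩ := exists_growth_bound g isCompact_unitCube hδ
    refine ⟨C, fun j => ?_⟩
    set M := N.blow (c := c j) (hr j) (hsub j) b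
    have hfinM := M.isFiniteMeasure_oscMeasure isBounded_unitCube
    have hfst : M.oscMeasure.map Prod.fst =
        (volume.restrict (closure (unitCube d))).prod volume := Measure.fst_compProd _ _
    have hmass : M.oscMeasure.real univ = B := by
      rw [hB, ← hfst, measureReal_def, measureReal_def, Measure.map_apply measurable_fst
        MeasurableSet.univ, preimage_univ]
    have hsupp : ∀ᵐ q ∂M.oscMeasure, q.1.1 ∈ unitCube d := by
      have h1 : ∀ᵐ p : Space d × Torus d ∂(M.oscMeasure.map Prod.fst), p.1 ∈ unitCube d := by
        rw [hfst]
        refine Measure.quasiMeasurePreserving_fst.ae (p := fun x => x ∈ unitCube d) ?_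
        filter_upwards [ae_restrict_mem hcl] with x hx
        rwa [isClosed_unitCube.closure_eq] at hx
      exact ae_of_ae_map measurable_fst.aemeasurable h1
    have hlim : ∫ p : Space d × Torus d, g (p.1, p.2, 0)
        ∂((volume.restrict (closure (unitCube d))).prod volume) =
        ∫ q, g (q.1.1, q.1.2, 0) ∂M.oscMeasure := by
      rw [← hfst, integral_map measurable_fst.aemeasurable
        (Measurable.aestronglyMeasurable (by fun_prop))]
    have hi1 : Integrable (fun q : (Space d × Torus d) × E =>
        (1 + ‖q.2‖) * g (q.1.1, q.1.2, hat q.2)) M.oscMeasure :=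
      Integrable.mul_bdd (c := ‖g‖)
        ((integrable_const (1 : ℝ)).add M.integrable_snd_oscMeasure.norm)
        (Measurable.aestronglyMeasurable (by fun_prop)) (ae_of_all _ fun q => g.norm_coe_le_norm _)
    have hi2 : Integrable (fun q : (Space d × Torus d) × E => g (q.1.1, q.1.2, 0)) M.oscMeasure :=
      .of_bound (Measurable.aestronglyMeasurable (by fun_prop)) ‖g‖
        (ae_of_all _ fun q => g.norm_coe_le_norm _)
    have hi3 : Integrable (fun q : (Space d × Torus d) × E => δ + C * ‖q.2‖) M.oscMeasure :=
      (integrable_const δ).add (M.integrable_snd_oscMeasure.norm.const_mul C)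
    rw [hlim, ← integral_sub hi1 hi2, ← Real.norm_eq_abs]
    calc _ ≤ ∫ q, (δ + C * ‖q.2‖) ∂M.oscMeasure := by
          refine norm_integral_le_of_norm_le hi3 ?_
          filter_upwards [hsupp] with q hq using hC _ hq _ _
      _ = _ := by
          rw [integral_add (integrable_const δ) (M.integrable_snd_oscMeasure.norm.const_mul C),
            integral_const, hmass, integral_const_mul,
            N.integral_norm_oscMeasure_blow (hr j) (hc j) (hsub j) b, smul_eq_mul, mul_comm B]
  rw [tendsto_iff_norm_sub_tendsto_zero]
  have hB0 : 0 ≤ B := measureReal_nonneg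
  rw [Metric.tendsto_atTop]
  intro ε hε
  obtain ⟨C, hC⟩ := key (ε / (2 * (B + 1))) (by positivity)
  have h1 : Tendsto (fun j => ε / (2 * (B + 1)) * B +
      C * (c j * (N.momentMeasure (cube x₀ (r j))).toReal)) atTop
      (𝓝 (ε / (2 * (B + 1)) * B + C * 0)) := tendsto_const_nhds.add (hmom.const_mul C)
  have h2 : ε / (2 * (B + 1)) * B + C * 0 < ε := by
    rw [mul_zero, add_zero, div_mul_eq_mul_div, div_lt_iff₀ (by positivity)]
    nlinarith
  refine eventually_atTop.1 ((h1.eventually_lt_const h2).mono fun j hj => ?_)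
  rw [Real.dist_eq, sub_zero, abs_norm]
  exact (hC j).trans_lt hj

end YoungKernels

end TangentLimit

end

noncomputable section

/-! ### Lebesgue points and the limit of concentrations -/

section Concentrations

open ProbabilityTheory
open scoped BoundedContinuousFunction NNReal ENNReal

variable {d : ℕ} {E : Type*} [NormedAddCommGroup E] [InnerProductSpace ℝ E]
  [MeasurableSpace E] [BorelSpace E] [FiniteDimensional ℝ E]

namespace YoungKernels

variable {D : Set (Space d)} (N : YoungKernels D E)

theorem integral_conc_blow {x₀ : Space d} {r c : ℝ} (hr : 0 < r) (hc : 0 < c)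
    (hsub : cube x₀ r ⊆ closure D) (b : Torus d) (g : Phase d E →ᵇ ℝ) :
    ∫ q, g (q.1.1, q.1.2, (q.2 : E)) ∂(N.blow (c := c) hr hsub b).concMeasure =
      c * ∫ x in cube x₀ r, N.angularAverage (angularSlice g b (blowMap x₀ r x)) x ∂N.lam := by
  have hbp := measurable_blowPair x₀ r b
  have hg := g.continuous.measurable
  rw [← N.setIntegral_concMeasure_slice (isClosed_cube x₀ r).measurableSet g b
    (blowMap_continuous x₀ r).measurable, concMeasure_blow, integral_smul_measure,
    integral_map (by fun_prop) (Measurable.aestronglyMeasurable (by fun_prop)),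
    ENNReal.toReal_ofReal hc.le, smul_eq_mul]
  rfl

/-- Almost every point for a finite measure is a Lebesgue point of all angular averages. -/
theorem ae_lebesgue_point_angularAverage (m : Measure (Space d)) [IsFiniteMeasure m] :
    ∀ᵐ x ∂m, ∀ φ : AngularTest d E,
      Tendsto (fun r => (∫⁻ y in cube x r, ‖N.angularAverage φ y - N.angularAverage φ x‖ₑ ∂m) /
        m (cube x r)) (𝓝[>] 0) (𝓝 0) := by
  obtain ⟨s, hs, hsd⟩ := TopologicalSpace.exists_countable_dense (AngularTest d E)
  have h1 : ∀ᵐ x ∂m, ∀ φ ∈ s, Tendsto (fun r =>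
      (∫⁻ y in cube x r, ‖N.angularAverage φ y - N.angularAverage φ x‖ₑ ∂m) /
        m (cube x r)) (𝓝[>] 0) (𝓝 0) :=
    (ae_ball_iff hs).2 fun φ _ => ae_tendsto_cube_lintegral_sub_div
      (.of_bound (N.measurable_angularAverage φ).aestronglyMeasurable ‖φ‖
        (ae_of_all _ fun x => N.abs_angularAverage_le φ x))
  filter_upwards [h1, ae_cube_pos m] with x hx hpos φ
  rw [ENNReal.tendsto_nhds_zero]
  intro ε hε
  -- The test is replaced by a dense one both at y and at x, which costs 2η.
  obtain ⟨η, hη, hηε⟩ : ∃ η : ℝ, 0 < η ∧ ENNReal.ofReal (2 * η) ≤ ε / 2 := by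
    have h2 : (0 : ℝ≥0∞) < ε / 2 := ENNReal.half_pos hε.ne'
    obtain ⟨t, ht0, ht⟩ := ENNReal.lt_iff_exists_nnreal_btwn.1 h2
    refine ⟨t / 2, by have : (0 : ℝ≥0) < t := by exact_mod_cast ht0
                      positivity, ?_⟩
    rw [mul_div_cancel₀ _ two_ne_zero, ENNReal.ofReal_coe_nnreal]
    exact ht.le
  obtain ⟨ψ, hψ, hψd⟩ := Metric.dense_iff.1 hsd φ η hη
  have hψ' : ‖φ - ψ‖ ≤ η := by
    rw [← dist_eq_norm, dist_comm]; exact (Metric.mem_ball.1 hψ).le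
  have hbound : ∀ y, ‖N.angularAverage φ y - N.angularAverage φ x‖ₑ ≤
      ‖N.angularAverage ψ y - N.angularAverage ψ x‖ₑ + ENNReal.ofReal (2 * η) := by
    intro y
    rw [← ofReal_norm, ← ofReal_norm, ← ENNReal.ofReal_add (norm_nonneg _) (by positivity)]
    refine ENNReal.ofReal_le_ofReal ?_
    have e1 := (N.abs_angularAverage_sub_le φ ψ y).trans hψ'
    have e2 := (N.abs_angularAverage_sub_le φ ψ x).trans hψ'
    rw [Real.norm_eq_abs, Real.norm_eq_abs]
    rw [abs_le] at e1 e2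
    have e3 := abs_le.1 (le_refl |N.angularAverage ψ y - N.angularAverage ψ x|)
    rw [abs_le]
    constructor <;> linarith [e1.1, e1.2, e2.1, e2.2, e3.1, e3.2]
  have h2 := (ENNReal.tendsto_nhds_zero.1 (hx ψ hψd)) (ε / 2) (ENNReal.half_pos hε.ne')
  filter_upwards [h2, self_mem_nhdsWithin] with r hr hr0
  have hm0 := (hpos r hr0).ne'
  calc (∫⁻ y in cube x r, ‖N.angularAverage φ y - N.angularAverage φ x‖ₑ ∂m) / m (cube x r)
      ≤ (∫⁻ y in cube x r, (‖N.angularAverage ψ y - N.angularAverage ψ x‖ₑ +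
          ENNReal.ofReal (2 * η)) ∂m) / m (cube x r) :=
        ENNReal.div_le_div_right (lintegral_mono hbound) _
    _ = (∫⁻ y in cube x r, ‖N.angularAverage ψ y - N.angularAverage ψ x‖ₑ ∂m) / m (cube x r) +
          ENNReal.ofReal (2 * η) := by
        rw [lintegral_add_right _ measurable_const, lintegral_const, Measure.restrict_apply_univ,
          ENNReal.add_div, ENNReal.mul_div_cancel_right hm0 (measure_ne_top _ _)]
    _ ≤ ε / 2 + ε / 2 := add_le_add hr hηε
    _ = ε := ENNReal.add_halves ε

/-- Three terms: the average frozen at x₀ against κ, which follows the tangent measure; the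
oscillation of the average on the cube, controlled by Lebesgue points; and the contribution of ρ,
negligible by density. -/
theorem tendsto_conc_blow {x₀ : Space d} {r : ℕ → ℝ} {κ ρ : Measure (Space d)}
    [IsFiniteMeasure κ] [IsFiniteMeasure ρ] (hlam : N.lam = κ + ρ) (hr : ∀ j, 0 < r j)
    (hpos : ∀ j, 0 < κ (cube x₀ (r j))) (hsub : ∀ j, cube x₀ (r j) ⊆ closure D) (b : Torus d)
    (hρ : Tendsto (fun j => (κ (cube x₀ (r j))).toReal⁻¹ * (ρ (cube x₀ (r j))).toReal)
      atTop (𝓝 0))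
    (hleb : ∀ φ : AngularTest d E, Tendsto (fun j => (κ (cube x₀ (r j))).toReal⁻¹ *
      ∫ y in cube x₀ (r j), |N.angularAverage φ y - N.angularAverage φ x₀| ∂κ) atTop (𝓝 0))
    {τ : Measure (Space d)}
    (hτ : ∀ φ : Space d → ℝ, Continuous φ →
      Tendsto (fun j => ∫ y, φ y ∂(blowUpProb κ x₀ (r j))) atTop (𝓝 (∫ y, φ y ∂τ)))
    (g : Phase d E →ᵇ ℝ) :
    Tendsto (fun j => ∫ q, g (q.1.1, q.1.2, (q.2 : E))
        ∂(N.blow (c := (κ (cube x₀ (r j))).toReal⁻¹) (hr j) (hsub j) b).concMeasure) atTop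
      (𝓝 (∫ y, N.angularAverage (angularSlice g b y) x₀ ∂τ)) := by
  set m : ℕ → ℝ := fun j => (κ (cube x₀ (r j))).toReal with hm
  have hm0 : ∀ j, 0 < m j := fun j => ENNReal.toReal_pos (hpos j).ne' (measure_ne_top _ _)
  set H : ℕ → Space d → ℝ := fun j x =>
    N.angularAverage (angularSlice g b (blowMap x₀ (r j) x)) x with hH
  set H₀ : ℕ → Space d → ℝ := fun j x =>
    N.angularAverage (angularSlice g b (blowMap x₀ (r j) x)) x₀ with hH₀
  have hHm : ∀ j, Measurable (H j) := fun j =>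
    N.measurable_angularAverage_slice g b (blowMap_continuous x₀ (r j)).measurable
  have hcont : Continuous fun y => N.angularAverage (angularSlice g b y) x₀ :=
    (N.continuous_angularAverage x₀).comp (angularSlice g b).continuous
  have hH₀m : ∀ j, Measurable (H₀ j) := fun j =>
    (hcont.comp (blowMap_continuous x₀ (r j))).measurable
  have hHb : ∀ j x, ‖H j x‖ ≤ ‖g‖ := fun j x =>
    (N.abs_angularAverage_le _ x).trans (norm_angularSlice_le g b _)
  have hH₀b : ∀ j x, ‖H₀ j x‖ ≤ ‖g‖ := fun j x =>
    (N.abs_angularAverage_le _ x₀).trans (norm_angularSlice_le g b _)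
  have hHi : ∀ j (ν : Measure (Space d)) [IsFiniteMeasure ν], Integrable (H j) ν := fun j ν _ =>
    .of_bound (hHm j).aestronglyMeasurable ‖g‖ (ae_of_all _ (hHb j))
  have hH₀i : ∀ j (ν : Measure (Space d)) [IsFiniteMeasure ν], Integrable (H₀ j) ν := fun j ν _ =>
    .of_bound (hH₀m j).aestronglyMeasurable ‖g‖ (ae_of_all _ (hH₀b j))
  have hsplit : ∀ j, ∫ q, g (q.1.1, q.1.2, (q.2 : E))
        ∂(N.blow (c := (κ (cube x₀ (r j))).toReal⁻¹) (hr j) (hsub j) b).concMeasure =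
      (m j)⁻¹ * (∫ x in cube x₀ (r j), H₀ j x ∂κ) +
        (m j)⁻¹ * (∫ x in cube x₀ (r j), (H j x - H₀ j x) ∂κ) +
        (m j)⁻¹ * ∫ x in cube x₀ (r j), H j x ∂ρ := by
    intro j
    rw [N.integral_conc_blow (hr j) (inv_pos.2 (hm0 j)) (hsub j) b g, hlam, Measure.restrict_add,
      integral_add_measure (hHi j _) (hHi j _), integral_sub (hHi j _) (hH₀i j _)]
    ring
  simp only [hsplit]
  have t1 : Tendsto (fun j => (m j)⁻¹ * (∫ x in cube x₀ (r j), H₀ j x ∂κ)) atTop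
      (𝓝 (∫ y, N.angularAverage (angularSlice g b y) x₀ ∂τ)) := by
    refine (hτ _ hcont).congr fun j => ?_
    rw [blowUpProb_eq κ x₀ (hr j), integral_smul_measure,
      (measurableEmbedding_blowMap x₀ (hr j).ne').integral_map, ENNReal.toReal_inv, smul_eq_mul]
  have t3 : Tendsto (fun j => (m j)⁻¹ * ∫ x in cube x₀ (r j), H j x ∂ρ) atTop (𝓝 0) := by
    have : Tendsto (fun j => ‖g‖ * ((m j)⁻¹ * (ρ (cube x₀ (r j))).toReal)) atTop (𝓝 (‖g‖ * 0)) :=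
      hρ.const_mul _
    rw [mul_zero] at this
    refine squeeze_zero_norm (fun j => ?_) this
    rw [norm_mul, norm_inv, Real.norm_of_nonneg (hm0 j).le]
    have h1 := norm_integral_le_of_norm_le_const (μ := ρ.restrict (cube x₀ (r j)))
      (ae_of_all _ (hHb j))
    rw [measureReal_restrict_apply_univ, measureReal_def] at h1
    calc _ ≤ (m j)⁻¹ * (‖g‖ * (ρ (cube x₀ (r j))).toReal) := by
          have := inv_pos.2 (hm0 j)
          gcongr
      _ = _ := by ring
  have t2 : Tendsto (fun j => (m j)⁻¹ * (∫ x in cube x₀ (r j), (H j x - H₀ j x) ∂κ)) atTop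
      (𝓝 0) := by
    rw [Metric.tendsto_atTop]
    intro ε hε
    -- The test slice moves with the point, but its values stay in a compact set; a finite net
    -- reduces the estimate to finitely many fixed tests.
    have htb : TotallyBounded (angularSlice g b '' unitCube d) :=
      (isCompact_unitCube.image (angularSlice g b).continuous).totallyBounded
    obtain ⟨t, ht, hcov⟩ := Metric.totallyBounded_iff.1 htb (ε / 4) (by positivity)
    have hsum : Tendsto (fun j => ∑ φ ∈ ht.toFinset, (m j)⁻¹ *
        ∫ y in cube x₀ (r j), |N.angularAverage φ y - N.angularAverage φ x₀| ∂κ) atTop (𝓝 0) := by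
      have := tendsto_finsetSum ht.toFinset fun φ _ => hleb φ
      simpa using this
    refine eventually_atTop.1 ((hsum.eventually_lt_const (half_pos hε)).mono fun j hj => ?_)
    rw [Real.dist_eq, sub_zero]
    have hcube : MeasurableSet (cube x₀ (r j)) := (isClosed_cube x₀ (r j)).measurableSet
    have hai : ∀ φ : AngularTest d E, Integrable
        (fun y => |N.angularAverage φ y - N.angularAverage φ x₀|) (κ.restrict (cube x₀ (r j))) :=
      fun φ => ((Integrable.of_bound (N.measurable_angularAverage φ).aestronglyMeasurable ‖φ‖
        (ae_of_all _ fun x => N.abs_angularAverage_le φ x)).sub (integrable_const _)).abs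
    have hpt : ∀ x ∈ cube x₀ (r j), ‖H j x - H₀ j x‖ ≤ ε / 2 +
        ∑ φ ∈ ht.toFinset, |N.angularAverage φ x - N.angularAverage φ x₀| := by
      intro x hx
      have hy : blowMap x₀ (r j) x ∈ unitCube d := by
        rwa [← mem_preimage, preimage_blowMap_unitCube x₀ (hr j)]
      obtain ⟨φ, hφ, hd⟩ := mem_iUnion₂.1 (hcov (mem_image_of_mem _ hy))
      have hd' : ‖angularSlice g b (blowMap x₀ (r j) x) - φ‖ ≤ ε / 4 := by
        rw [← dist_eq_norm]; exact (Metric.mem_ball.1 hd).le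
      have e1 := (N.abs_angularAverage_sub_le _ φ x).trans hd'
      have e2 := (N.abs_angularAverage_sub_le _ φ x₀).trans hd'
      have e4 := Finset.single_le_sum
        (f := fun φ => |N.angularAverage φ x - N.angularAverage φ x₀|)
        (fun _ _ => abs_nonneg _) (ht.mem_toFinset.2 hφ)
      have e3 := abs_le.1 (le_refl |N.angularAverage φ x - N.angularAverage φ x₀|)
      rw [abs_le] at e1 e2
      rw [Real.norm_eq_abs, abs_le]
      constructor <;> simp only [hH, hH₀] <;> linarith [e1.1, e1.2, e2.1, e2.2, e3.1, e3.2]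
    have hbi : Integrable (fun x => ε / 2 +
        ∑ φ ∈ ht.toFinset, |N.angularAverage φ x - N.angularAverage φ x₀|)
        (κ.restrict (cube x₀ (r j))) :=
      (integrable_const _).add (integrable_finsetSum _ fun φ _ => hai φ)
    have hle : ‖∫ x in cube x₀ (r j), (H j x - H₀ j x) ∂κ‖ ≤ ε / 2 * m j +
        ∑ φ ∈ ht.toFinset,
          ∫ y in cube x₀ (r j), |N.angularAverage φ y - N.angularAverage φ x₀| ∂κ := by
      refine (norm_integral_le_of_norm_le hbi ?_).trans_eq ?_
      · filter_upwards [ae_restrict_mem hcube] with x hx using hpt x hx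
      · rw [integral_add (integrable_const _) (integrable_finsetSum _ fun φ _ => hai φ),
          integral_finsetSum _ fun φ _ => hai φ, integral_const, measureReal_restrict_apply_univ,
          smul_eq_mul, mul_comm]
        rfl
    rw [← Finset.mul_sum] at hj
    rw [abs_mul, abs_of_pos (inv_pos.2 (hm0 j))]
    rw [Real.norm_eq_abs] at hle
    calc _ ≤ (m j)⁻¹ * (ε / 2 * m j + ∑ φ ∈ ht.toFinset,
          ∫ y in cube x₀ (r j), |N.angularAverage φ y - N.angularAverage φ x₀| ∂κ) := by
          have := inv_pos.2 (hm0 j)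
          gcongr
      _ = ε / 2 + (m j)⁻¹ * ∑ φ ∈ ht.toFinset,
          ∫ y in cube x₀ (r j), |N.angularAverage φ y - N.angularAverage φ x₀| ∂κ := by
          have := (hm0 j).ne'
          field_simp
      _ < ε := by linarith
  simpa using (t1.add t2).add t3

/-- The oscillation part always carries at least the volume of Q, since its weight 1 + |z| is at
least 1. This permits normalization in the diagonal argument. -/
theorem lift_ne_zero (M : YoungKernels (unitCube d) E) : M.lift ≠ 0 := by
  intro h
  have hfin := M.isFiniteMeasure_oscMeasure isBounded_unitCube
  have h1 := M.integral_lift isBounded_unitCube (g := fun _ => 1) measurable_const (C := 1)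
    (fun _ => by simp)
  rw [h, integral_zero_measure] at h1
  have hfst : M.oscMeasure.map Prod.fst =
      (volume.restrict (closure (unitCube d))).prod volume := Measure.fst_compProd _ _
  have hpos : 0 < M.oscMeasure.real univ := by
    have hvol : 0 < volume (unitCube d) :=
      Measure.measure_pos_of_mem_nhds _ (cube_mem_nhds (0 : Space d) one_pos)
    have : M.oscMeasure univ = volume (unitCube d) := by
      rw [← preimage_univ (f := Prod.fst), ← Measure.map_apply measurable_fst MeasurableSet.univ,
        hfst, ← univ_prod_univ, Measure.prod_prod, isClosed_unitCube.closure_eq,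
        Measure.restrict_apply_univ, volume_pi, Measure.pi_univ]
      simp
    rw [measureReal_def, this]
    exact ENNReal.toReal_pos hvol.ne' isBounded_unitCube.measure_lt_top.ne
  have h2 : M.oscMeasure.real univ ≤ ∫ q, (1 + ‖q.2‖) * 1 ∂M.oscMeasure := by
    have : M.oscMeasure.real univ = ∫ _q, (1 : ℝ) ∂M.oscMeasure := by simp
    rw [this]
    refine integral_mono (integrable_const _)
      (((integrable_const (1 : ℝ)).add M.integrable_snd_oscMeasure.norm).mul_const 1) fun q => ?_
    simp
  have h3 : 0 ≤ ∫ _q, (1 : ℝ) ∂M.concMeasure := integral_nonneg fun _ => zero_le_one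
  linarith

end YoungKernels

end Concentrations

end

noncomputable section

/-! ### Assembly of the tangent Young measure -/

section Main

open ProbabilityTheory
open scoped BoundedContinuousFunction NNReal ENNReal

variable {d : ℕ} {E : Type*} [NormedAddCommGroup E] [InnerProductSpace ℝ E]
  [MeasurableSpace E] [BorelSpace E] [FiniteDimensional ℝ E]

theorem eventually_cube_subset {x₀ : Space d} {U : Set (Space d)} (hU : U ∈ 𝓝 x₀) :
    ∀ᶠ r in 𝓝[>] (0 : ℝ), cube x₀ r ⊆ U := by
  have h1 : toSup d '' U ∈ 𝓝 (toSup d x₀) :=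
    (PiLp.homeomorph 2 fun _ : Fin d => ℝ).isOpenMap.image_mem_nhds hU
  obtain ⟨δ, hδ, hball⟩ := Metric.nhds_basis_closedBall.mem_iff.1 h1
  filter_upwards [Ioc_mem_nhdsGT hδ] with r hr
  rw [← preimage_toSup_closedBall x₀ hr.1.le]
  intro y hy
  obtain ⟨z, hz, hzy⟩ := hball (Metric.closedBall_subset_closedBall (by linarith [hr.1, hr.2]) hy)
  rwa [← (toSup d).injective hzy]

/-- The blow-ups of `N` converge to a homogeneous tangent Young measure. -/
theorem YoungKernels.tendsto_lift_blow {D : Set (Space d)} (N : YoungKernels D E)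
    {x₀ : Space d} {r : ℕ → ℝ} {κ ρ : Measure (Space d)}
    [IsFiniteMeasure κ] [IsFiniteMeasure ρ] (hlam : N.lam = κ + ρ) (hr : ∀ j, 0 < r j)
    (hr0 : Tendsto r atTop (𝓝 0)) (hpos : ∀ j, 0 < κ (cube x₀ (r j)))
    (hsub : ∀ j, cube x₀ (r j) ⊆ closure D) (b : Torus d)
    (hmom : Tendsto (fun r => N.momentMeasure (cube x₀ r) / κ (cube x₀ r)) (𝓝[>] 0) (𝓝 0))
    (hρ : Tendsto (fun r => ρ (cube x₀ r) / κ (cube x₀ r)) (𝓝[>] 0) (𝓝 0))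
    (hleb : ∀ φ : AngularTest d E, Tendsto (fun r =>
      (∫⁻ y in cube x₀ r, ‖N.angularAverage φ y - N.angularAverage φ x₀‖ₑ ∂κ) / κ (cube x₀ r))
      (𝓝[>] 0) (𝓝 0))
    {τ : Measure (Space d)} [IsFiniteMeasure τ] (hτQ : τ (unitCube d)ᶜ = 0)
    (hτ : ∀ φ : Space d → ℝ, Continuous φ →
      Tendsto (fun j => ∫ y, φ y ∂(blowUpProb κ x₀ (r j))) atTop (𝓝 (∫ y, φ y ∂τ)))
    (g : Phase d E →ᵇ ℝ) :
    Tendsto (fun j => ∫ q, g q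
        ∂(N.blow (c := (κ (cube x₀ (r j))).toReal⁻¹) (hr j) (hsub j) b).lift) atTop
      (𝓝 (∫ q, g q ∂(N.tangent x₀ b τ hτQ).lift)) := by
  have hrw : Tendsto r atTop (𝓝[>] 0) :=
    tendsto_nhdsWithin_iff.2 ⟨hr0, Eventually.of_forall hr⟩
  have hc : ∀ j, 0 < (κ (cube x₀ (r j))).toReal⁻¹ := fun j =>
    inv_pos.2 (ENNReal.toReal_pos (hpos j).ne' (measure_ne_top _ _))
  -- Passes from extended quotients as the radius decreases to 0 to real sequences along the chosen
  -- radii.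
  have toR : ∀ {F : ℝ → ℝ≥0∞}, Tendsto (fun r => F r / κ (cube x₀ r)) (𝓝[>] 0) (𝓝 0) →
      Tendsto (fun j => (κ (cube x₀ (r j))).toReal⁻¹ * (F (r j)).toReal) atTop (𝓝 0) := by
    intro F hF
    have h := (ENNReal.tendsto_toReal ENNReal.zero_ne_top).comp (hF.comp hrw)
    refine (by simpa using h : Tendsto _ _ (𝓝 (0 : ℝ))).congr fun j => ?_
    simp only [Function.comp_apply, ENNReal.toReal_div]
    rw [div_eq_mul_inv, mul_comm]
  rw [N.integral_tangent_lift]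
  simp only [YoungKernels.integral_lift _ isBounded_unitCube g.continuous.measurable
    g.norm_coe_le_norm]
  refine (N.tendsto_osc_blow hr hc hsub b (toR hmom) g).add
    (N.tendsto_conc_blow hlam hr hpos hsub b (toR hρ) (fun φ => ?_) hτ g)
  refine (toR (hleb φ)).congr fun j => ?_
  congr 1
  rw [← integral_norm_eq_lintegral_enorm]
  · rfl
  · exact ((N.measurable_angularAverage φ).sub_const _).aestronglyMeasurable

end Main

end

theorem proposition4p2 {d : ℕ} {E : Type*} [NormedAddCommGroup E] [InnerProductSpace ℝ E]
    [FiniteDimensional ℝ E] [MeasurableSpace E] [BorelSpace E]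
    (Ω : Set (Space d)) (hΩ_open : IsOpen Ω) (hΩ_bounded : Bornology.IsBounded Ω)
    (hΩ_null : volume (frontier Ω) = 0)
    (ν : TwoScaleYoungMeasure Ω E)
    (ε : ℕ → ℝ) (μ : ℕ → VectorMeasure (Space d) E) (hgen : Generates ε μ ν) :
    ∃ S : Set (Space d), S ⊆ Ω ∧ ν.lamSing (Ω \ S) = 0 ∧
      ∀ x₀ ∈ S, ∃ (ξ₀ : Torus d) (Dν : TwoScaleYoungMeasure (unitCube d) E),
        IsTangentYoungMeasure ε μ ν.lamSing x₀ Dν ∧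
        IsTangentMeasure ν.lamSing x₀ Dν.lam ∧
        (∀ᵐ y ∂Dν.lam, Dν.rho y = (ν.rho x₀).map (fun ξ => ξ - ξ₀)) ∧
        (∀ᵐ p : Space d × Torus d ∂((volume.restrict (unitCube d)).prod volume),
          Dν.osc p.1 p.2 = Measure.dirac 0) ∧
        (∀ᵐ p : Space d × Torus d ∂(semiProd Dν.lam Dν.rho),
          Dν.conc p.1 p.2 = ν.conc x₀ (p.2 + ξ₀)) := by
  have hνfin := ν.lam_finite
  -- Without unit vectors there is no probability measure on the sphere, which forces λ = 0, and the
  -- empty set of points works.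
  rcases isEmpty_or_nonempty (Metric.sphere (0 : E) 1) with hemp | hne
  · have hlam : ν.lam = 0 := by
      have h1 : ∀ᵐ p : Space d × Torus d ∂(semiProd ν.lam ν.rho), False := by
        filter_upwards [ν.conc_prob] with p hp
        have := hp.measure_univ
        rw [univ_eq_empty_iff.2 hemp, measure_empty] at this
        exact zero_ne_one this
      obtain ⟨κ, hκ, hκρ⟩ := exists_kernel_ae_eq ν.rho_measurable ν.rho_prob
      rw [semiProd_congr hκρ, semiProd_kernel, ae_iff] at h1
      simpa using h1
    refine ⟨∅, empty_subset _, ?_, fun x hx => hx.elim⟩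
    simp [TwoScaleYoungMeasure.lamSing, hlam]
  obtain ⟨N, hN⟩ := YoungKernels.exists_represents ν
  have hΩm := hΩ_open.measurableSet
  have hΩ0 : volume (closure Ω \ Ω) = 0 := by rwa [← hΩ_open.frontier_eq]
  obtain ⟨hε, hε0, hμ, hconv⟩ := (generates_iff hN hΩ_bounded hΩm hΩ0).1 hgen
  set κ := ν.lamSing with hκ
  have hκN : κ = N.lam.singularPart volume := by
    rw [hκ, TwoScaleYoungMeasure.lamSing, hN.lam_eq]
  have hκfin : IsFiniteMeasure κ := by rw [hκN]; infer_instance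
  set ρ := (volume : Measure (Space d)).withDensity (N.lam.rnDeriv volume) with hρdef
  have hlam : N.lam = κ + ρ := by
    rw [hκN]; exact (N.lam.haveLebesgueDecomposition_add volume)
  have hρfin : IsFiniteMeasure ρ :=
    isFiniteMeasure_of_le N.lam (by rw [hlam]; exact Measure.le_add_left le_rfl)
  have hκsing : κ ⟂ₘ volume := by
    rw [hκN]; exact Measure.mutuallySingular_singularPart _ _
  have hκlam : κ ≪ N.lam := by
    rw [hκN]; exact (Measure.singularPart_le _ _).absolutelyContinuous
  have hmoms : N.momentMeasure ⟂ₘ κ :=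
    hκsing.symm.mono_ac N.momentMeasure_absolutelyContinuous .rfl
  have hρs : ρ ⟂ₘ κ := hκsing.symm.mono_ac (withDensity_absolutelyContinuous _ _) .rfl
  -- The last two conditions tie the kernels at x to the given components of ν; they are needed
  -- since ν is evaluated at the single point x₀.
  let Good : Space d → Prop := fun x =>
      (∀ r, 0 < r → 0 < κ (cube x r)) ∧
      Tendsto (fun r => N.momentMeasure (cube x r) / κ (cube x r)) (𝓝[>] 0) (𝓝 0) ∧
      Tendsto (fun r => ρ (cube x r) / κ (cube x r)) (𝓝[>] 0) (𝓝 0) ∧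
      (∀ φ : AngularTest d E, Tendsto (fun r =>
        (∫⁻ y in cube x r, ‖N.angularAverage φ y - N.angularAverage φ x‖ₑ ∂κ) / κ (cube x r))
        (𝓝[>] 0) (𝓝 0)) ∧
      ν.rho x = N.rho x ∧ ∀ᵐ ξ ∂N.rho x, ν.conc x ξ = N.conc (x, ξ)
  have hgood : ∀ᵐ x ∂κ, Good x := by
    filter_upwards [ae_cube_pos κ, ae_tendsto_cube_div_of_mutuallySingular hmoms,
      ae_tendsto_cube_div_of_mutuallySingular hρs, N.ae_lebesgue_point_angularAverage κ,
      hκlam.ae_le hN.rho_ae, hκlam.ae_le (Measure.ae_ae_of_ae_compProd hN.conc_ae)]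
      with x h1 h2 h3 h4 h5 h6 using ⟨h1, h2, h3, h4, h5, h6⟩
  refine ⟨{x | x ∈ Ω ∧ Good x}, fun x hx => hx.1,
    measure_mono_null (fun x hx hx' => hx.2 ⟨hx.1, hx'⟩) hgood, ?_⟩
  rintro x₀ ⟨hx₀, hpos, hmom, hρ0, hleb, hrho, hconc⟩
  -- This fixes ξ₀ and the subsequence before any radius is chosen, so both serve all radii at once.
  obtain ⟨b, s, hs, hb⟩ := CompactSpace.tendsto_subseq fun i => toTorus ((ε i)⁻¹ • x₀)
  obtain ⟨δ, hδ, hδsub⟩ := mem_nhdsGT_iff_exists_Ioo_subset.1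
    (eventually_cube_subset (hΩ_open.mem_nhds hx₀))
  have hδ : (0 : ℝ) < δ := hδ
  -- Adding `volume` makes the frontier null for λ and Lebesgue measure simultaneously, as passage
  -- to the limit in the cube requires.
  have hrad : ∀ j : ℕ, ∃ r, 0 < r ∧ r < min δ (1 / ((j : ℝ) + 1)) ∧
      (N.lam + volume : Measure (Space d)) (frontier (cube x₀ r)) = 0 := fun j =>
    exists_radius_frontier_null _ x₀ (lt_min hδ Nat.one_div_pos_of_nat)
  choose R hR0 hRlt hRnull using hrad
  obtain ⟨t, τ, ht, hτprob, hτQ, hτ⟩ :=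
    exists_subseq_tangentMeasure κ x₀ hR0 fun j => hpos _ (hR0 j)
  have hRlim : Tendsto R atTop (𝓝 0) :=
    squeeze_zero (fun j => (hR0 j).le) (fun j => ((hRlt j).trans_le (min_le_right _ _)).le)
      tendsto_one_div_add_atTop_nhds_zero_nat
  set r : ℕ → ℝ := R ∘ t with hrdef
  have hr : ∀ j, 0 < r j := fun j => hR0 _
  have hrlim : Tendsto r atTop (𝓝 0) := hRlim.comp ht.tendsto_atTop
  have hrpos : ∀ j, 0 < κ (cube x₀ (r j)) := fun j => hpos _ (hr j)
  have hrΩ : ∀ j, cube x₀ (r j) ⊆ Ω := fun j =>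
    hδsub ⟨hr j, (hRlt _).trans_le (min_le_left _ _)⟩
  have hsub : ∀ j, cube x₀ (r j) ⊆ closure Ω := fun j => (hrΩ j).trans subset_closure
  have hnull : ∀ j, N.lam (frontier (cube x₀ (r j))) = 0 ∧
      volume (frontier (cube x₀ (r j))) = 0 := fun j => by
    have := hRnull (t j)
    rwa [Measure.add_apply, add_eq_zero] at this
  have hc : ∀ j, 0 < (κ (cube x₀ (r j))).toReal⁻¹ := fun j =>
    inv_pos.2 (ENNReal.toReal_pos (hrpos j).ne' (measure_ne_top _ _))
  let M : ℕ → YoungKernels (unitCube d) E := fun j =>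
    N.blow (c := (κ (cube x₀ (r j))).toReal⁻¹) (hr j) (hsub j) b
  let T : YoungKernels (unitCube d) E := N.tangent x₀ b τ hτQ
  have hQm : MeasurableSet (unitCube d) := isClosed_unitCube.measurableSet
  have hQ0 : volume (closure (unitCube d) \ unitCube d) = 0 := by
    rw [isClosed_unitCube.closure_eq, sdiff_self, measure_empty]
  have hMT : ∀ g : BoundedContinuousFunction (Phase d E) ℝ,
      Tendsto (fun j => ∫ q, g q ∂(M j).lift) atTop (𝓝 (∫ q, g q ∂T.lift)) :=
    N.tendsto_lift_blow hlam hr hrlim hrpos hsub b hmom hρ0 hleb hτQ hτ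
  have hgenM : ∀ j, ∀ g : BoundedContinuousFunction (Phase d E) ℝ,
      Tendsto (fun i => ∫ q, g q ∂functionalLift (unitCube d) (ε (s i) / r j)
        (blowUp (κ (cube x₀ (r j))).toReal⁻¹ x₀ (r j) (μ (s i)))) atTop
        (𝓝 (∫ q, g q ∂(M j).lift)) := fun j g =>
    N.generates_blow (ε := fun i => ε (s i)) (μ := fun i => μ (s i)) (hr j) (hsub j) b
      hΩ_bounded hΩm (hrΩ j) (fun g => (hconv g).comp hs.tendsto_atTop) hb (hc j)
      (hnull j).2 (hnull j).1 g
  have hsupp : ∀ (c r : ℝ) (m : VectorMeasure (Space d) E),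
      (blowUp c x₀ r m).restrict (unitCube d) = blowUp c x₀ r m := by
    intro c r m
    ext1 A hA
    rw [VectorMeasure.restrict_apply _ hQm hA, blowUp_apply _ _ _ _ (hA.inter hQm),
      blowUp_apply _ _ _ _ hA, inter_assoc, inter_self]
  have hscale : ∀ j, Tendsto (fun i => ε (s i) / r j) atTop (𝓝 0) := fun j => by
    simpa using (hε0.comp hs.tendsto_atTop).div_const (r j)
  have hfinF : ∀ j i, IsFiniteMeasure (functionalLift (unitCube d) (ε (s i) / r j)
      (blowUp (κ (cube x₀ (r j))).toReal⁻¹ x₀ (r j) (μ (s i)))) := fun j i =>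
    isFiniteMeasure_functionalLift isBounded_unitCube _ _
  have hfinM : ∀ j, IsFiniteMeasure (M j).lift := fun j =>
    (M j).isFiniteMeasure_lift isBounded_unitCube
  have hfinT : IsFiniteMeasure T.lift := T.isFiniteMeasure_lift isBounded_unitCube
  -- The extra predicate forces the rescaled scales to tend to 0 along the diagonal, which
  -- convergence for each fixed radius does not give.
  obtain ⟨k, hk, hkε, hkgen⟩ := exists_diagonal_weak (u := fun j i =>
      functionalLift (unitCube d) (ε (s i) / r j)
        (blowUp (κ (cube x₀ (r j))).toReal⁻¹ x₀ (r j) (μ (s i))))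
    (v := fun j => (M j).lift) (w := T.lift) (fun j => (M j).lift_ne_zero) T.lift_ne_zero
    hgenM hMT (P := fun j i => ε (s i) / r j < 1 / ((j : ℝ) + 1)) fun j =>
      (hscale j).eventually_lt_const Nat.one_div_pos_of_nat
  have hτfin : IsFiniteMeasure τ := inferInstance
  have hconc' : ∀ᵐ p : Space d × Torus d ∂(semiProd T.toYoung.lam T.toYoung.rho),
      T.toYoung.conc p.1 p.2 = ν.conc x₀ (p.2 + b) := by
    have hemb : MeasurableEmbedding fun ξ : Torus d => ξ - b :=
      (MeasurableEquiv.subRight b).measurableEmbedding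
    have h1 : semiProd T.toYoung.lam T.toYoung.rho =
        τ.prod ((N.rho x₀).map fun ξ => ξ - b) := by
      have := semiProd_kernel τ T.rho
      rw [show semiProd T.toYoung.lam T.toYoung.rho = semiProd τ fun x => T.rho x from rfl, this]
      exact Measure.compProd_const
    rw [h1]
    refine Measure.quasiMeasurePreserving_snd.ae
      (p := fun ξ => N.conc (x₀, ξ + b) = ν.conc x₀ (ξ + b)) ?_
    rw [hemb.ae_map_iff]
    filter_upwards [hconc] with ξ hξ
    rw [sub_add_cancel, hξ]
  refine ⟨b, T.toYoung, ?_, ?_, ?_, ?_, hconc'⟩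
  · refine ⟨r, hr, hrlim, hrpos, s, hs, ⟨fun j => (M j).toYoung, fun j => ?_, ?_⟩, k, hk, ?_⟩
    · exact (generates_iff (M j).represents_toYoung isBounded_unitCube hQm hQ0).2
        ⟨fun i => div_pos (hε _) (hr j), hscale j, fun i => hsupp _ _ _, hgenM j⟩
    · exact weakStarTendsto_of_lift isBounded_unitCube hQm hQ0 hMT
    · refine (generates_iff T.represents_toYoung isBounded_unitCube hQm hQ0).2
        ⟨fun j => div_pos (hε _) (hr j), ?_, fun j => hsupp _ _ _, hkgen⟩
      exact squeeze_zero (fun j => (div_pos (hε _) (hr j)).le) (fun j => (hkε j).le)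
        tendsto_one_div_add_atTop_nhds_zero_nat
  · exact ⟨hτprob, hτQ, r, hr, hrlim, hrpos, hτ⟩
  · refine ae_of_all _ fun y => ?_
    rw [hrho]
    rfl
  · exact ae_of_all _ fun p => rfl
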